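/- **Conventions.** Manifolds are smooth, finite-dimensional and Hausdorff, without boundary. Let $\bar g$ be a pseudo-Riemannian metric on a manifold $N$ and $\Pi$ a bivector field on $N$. Write $\sharp_{\bar g}$, $\flat_{\bar g}$ for the musical isomorphisms, $\tilde g(\alpha,\beta)=\bar g(\sharp_{\bar g}\alpha,\sharp_{\bar g}\beta)$ for the cometric, and $\sharp_\Pi:T^*N\to TN$ for the anchor, $\beta(\sharp_\Pi\alpha)=\Pi(\alpha,\beta)$. The field $J$ of endomorphisms of $T^*N$ is given by $\Pi(\alpha,\beta)=\tilde g(J\alpha,\beta)$, and the Koszul bracket of one-forms is $$[\alpha,\beta]_\Pi=\mathcal L_{\sharp_\Pi\alpha}\beta-\mathcal L_{\sharp_\Pi\beta}\alpha-d(\Pi(\alpha,\beta)).$$ A contravariant connection $\mathcal D$ on $(N,\Pi)$ is an $\mathbb R$-bilinear operation on one-forms with $\mathcal D_{f\alpha}\beta=f\mathcal D_\alpha\beta$ and $\mathcal D_\alpha(f\beta)=f\mathcal D_\alpha\beta+(\sharp_\Pi\alpha)(f)\,\beta$. The Levi-Civita connection of $(\tilde g,\Pi)$ is the unique contravariant connection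 with $$\mathcal D_\alpha\beta-\mathcal D_\beta\alpha=[\alpha,\beta]_\Pi,\qquad (\sharp_\Pi\alpha)\,\tilde g(\beta,\gamma)=\tilde g(\mathcal D_\alpha\beta,\gamma)+\tilde g(\beta,\mathcal D_\alpha\gamma).$$ Its curvature is $\mathcal R(\alpha,\beta)\gamma=\mathcal D_\alpha\mathcal D_\beta\gamma-\mathcal D_\beta\mathcal D_\alpha\gamma-\mathcal D_{[\alpha,\beta]_\Pi}\gamma$, and at the points where the denominator is not zero its sectional curvature is $$\mathcal K(\alpha,\beta)=\frac{\tilde g(\mathcal R(\alpha,\beta)\beta,\alpha)}{\tilde g(\alpha,\alpha)\tilde g(\beta,\beta)-\tilde g(\alpha,\beta)^2}.$$ **Setting.** For $i=1,2$ let $M_i$ be a manifold with a pseudo-Riemannian metric $\bar g_i$ and a Poisson tensor $\Pi_i$, with associated $\tilde g_i$, $J_i$, $\mathcal D^{M_i}$, $\mathcal K^{M_i}$. Let $f_1,\nu_1\in C^\infty(M_1)$ with $f_1>0$. On $M=M_1\times M_2$ with projections $\pi_1,\pi_2$, consider the warped metric $\bar g^{f_1}=\pi_1^*\bar g_1+(f_1\circ\pi_1)^2\,\pi_2^*\bar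 g_2$ with its cometric $\tilde g^{f_1}$, and the bivector field $\Pi^{\nu_1}=\Pi_1+\nu_1\Pi_2$, that is, $\sharp_{\Pi^{\nu_1}}(\alpha)=(\sharp_{\Pi_1}\alpha_1)^h+\nu_1(\sharp_{\Pi_2}\alpha_2)^v$, where $\alpha_i$ is the restriction of the covector $\alpha$ to the $i$-th factor and $h$, $v$ denote the lifts of tangent vectors along the two factors. Let $\mathcal K^M$ be the sectional curvature of $(M,\tilde g^{f_1},\Pi^{\nu_1})$. For one-forms $\omega_1,\eta_1$ on $M_1$ and $\omega_2,\eta_2$ on $M_2$ write $\omega_1^h=\pi_1^*\omega_1$, $\omega_2^v=\pi_2^*\omega_2$, and so on. **Lemma.** At every point $(p,q)\in M_1\times M_2$ the following hold, where functions on $M_1$ are evaluated at $p$ and functions on $M_2$ at $q$. 1. If $\tilde g_1(\omega_1,\omega_1)\tilde g_1(\eta_1,\eta_1)-\tilde g_1(\omega_1,\eta_1)^2\ne0$ at $p$, then $$\mathcal K^M(\omega_1^h,\eta_1^h)=\mathcal K^{M_1}(\omega_1,\eta_1).$$ 2. If $\tilde g_1(\omega_1,\omega_1)\neq0$ at $p$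 and $\tilde g_2(\eta_2,\eta_2)\ne0$ at $q$, then $$\mathcal K^M(\omega_1^h,\eta_2^v)=-\frac{\tilde g_1(\mathcal D^{M_1}_{\omega_1}J_1df_1,\omega_1)}{f_1\,\tilde g_1(\omega_1,\omega_1)}-\frac{2\,\tilde g_1(J_1df_1,\omega_1)^2}{f_1^2\,\tilde g_1(\omega_1,\omega_1)}+\frac{\tilde g_2(J_2\eta_2,J_2\eta_2)\,\bigl(f_1^2\,\tilde g_1(d\nu_1,\omega_1)\bigr)^2}{4\,\tilde g_1(\omega_1,\omega_1)\,\tilde g_2(\eta_2,\eta_2)}.$$ 3. If $\tilde g_2(\omega_2,\omega_2)\tilde g_2(\eta_2,\eta_2)-\tilde g_2(\omega_2,\eta_2)^2\ne0$ at $q$, then $$\begin{aligned}\mathcal K^M(\omega_2^v,\eta_2^v)={}&\nu_1^2f_1^2\,\mathcal K^{M_2}(\omega_2,\eta_2)-\frac{\tilde g_1(J_1df_1,J_1df_1)}{f_1^2}\\&-\frac{3f_1^4\,\tilde g_1(d\nu_1,d\nu_1)\,\tilde g_2(J_2\omega_2,\eta_2)^2+4f_1\,\tilde g_1(d\nu_1,J_1df_1)\,\tilde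 g_2(\omega_2,\eta_2)\,\tilde g_2(J_2\omega_2,\eta_2)}{4\bigl(\tilde g_2(\omega_2,\omega_2)\tilde g_2(\eta_2,\eta_2)-\tilde g_2(\omega_2,\eta_2)^2\bigr)}.\end{aligned}$$ -/

import Mathlib

namespace PoissonWarped
open Bundle Set Filter FiberBundle VectorField
open scoped Manifold ContDiff Topology

noncomputable section

section Bundles

variable {B F₁ F₂ M : Type*} {n : ℕ∞ω}
  {E₁ : B → Type*} {E₂ : B → Type*}
  [∀ x, AddCommGroup (E₁ x)] [∀ x, Module ℝ (E₁ x)] [NormedAddCommGroup F₁] [NormedSpace ℝ F₁]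
  [TopologicalSpace (TotalSpace F₁ E₁)] [∀ x, TopologicalSpace (E₁ x)] [∀ x, AddCommGroup (E₂ x)]
  [∀ x, Module ℝ (E₂ x)] [NormedAddCommGroup F₂] [NormedSpace ℝ F₂]
  [TopologicalSpace (TotalSpace F₂ E₂)] [∀ x, TopologicalSpace (E₂ x)]
  {EB : Type*}
  [NormedAddCommGroup EB] [NormedSpace ℝ EB] {HB : Type*} [TopologicalSpace HB]
  {IB : ModelWithCorners ℝ EB HB} [TopologicalSpace B] [ChartedSpace HB B] {EM : Type*}
  [NormedAddCommGroup EM] [NormedSpace ℝ EM] {HM : Type*} [TopologicalSpace HM]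
  {IM : ModelWithCorners ℝ EM HM} [TopologicalSpace M] [ChartedSpace HM M]
  [FiberBundle F₁ E₁] [VectorBundle ℝ F₁ E₁]
  [FiberBundle F₂ E₂] [VectorBundle ℝ F₂ E₂]
  [∀ x, IsTopologicalAddGroup (E₂ x)] [∀ x, ContinuousSMul ℝ (E₂ x)]

theorem contMDiffAt_clm_of_apply [FiniteDimensional ℝ F₁] {f : M → F₁ →L[ℝ] F₂} {x : M}
    (h : ∀ v, ContMDiffAt IM 𝓘(ℝ, F₂) n (fun m => f m v) x) :
    ContMDiffAt IM 𝓘(ℝ, F₁ →L[ℝ] F₂) n f x := by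
  let d := Module.finrank ℝ F₁
  have hd : d = Module.finrank ℝ (Fin d → ℝ) := (Module.finrank_fin_fun ℝ).symm
  let e₁ := ContinuousLinearEquiv.ofFinrankEq hd
  let e₂ := (e₁.arrowCongr (1 : F₂ ≃L[ℝ] F₂)).trans (ContinuousLinearEquiv.piRing (Fin d))
  have : ContMDiffAt IM 𝓘(ℝ, F₁ →L[ℝ] F₂) n (fun m => e₂.symm (e₂ (f m))) x := by
    refine (e₂.symm.contDiff.contMDiff (n := n)).contMDiffAt.comp x ?_
    refine contMDiffAt_pi_space.2 fun i => h _
  simpa using this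

/-- A fibrewise linear map between vector bundles is smooth if it sends smooth sections to smooth
sections. -/
theorem contMDiffAt_hom_of_apply [FiniteDimensional ℝ F₁] [ContMDiffVectorBundle n F₁ E₁ IB]
    {b : M → B} {φ : ∀ m, E₁ (b m) →L[ℝ] E₂ (b m)} {x : M} (hb : ContMDiffAt IM IB n b x)
    (h : ∀ σ : Π y, E₁ y, ContMDiffAt IB (IB.prod 𝓘(ℝ, F₁)) n
        (fun y => TotalSpace.mk' F₁ y (σ y)) (b x) →
      ContMDiffAt IM (IB.prod 𝓘(ℝ, F₂)) n
        (fun m => TotalSpace.mk' F₂ (b m) (φ m (σ (b m)))) x) :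
    ContMDiffAt IM (IB.prod 𝓘(ℝ, F₁ →L[ℝ] F₂)) n
      (fun m => TotalSpace.mk' (F₁ →L[ℝ] F₂) (E := fun y => (E₁ y →L[ℝ] E₂ y)) (b m) (φ m)) x := by
  rw [contMDiffAt_hom_bundle]
  refine ⟨hb, contMDiffAt_clm_of_apply fun v => ?_⟩
  have h1 := h _ (contMDiffAt_extend IB F₁ (k := n)
    ((trivializationAt F₁ E₁ (b x)).symm (b x) v))
  rw [contMDiffAt_totalSpace] at h1
  refine h1.2.congr_of_eventuallyEq ?_
  have : ∀ᶠ m in 𝓝 x, b m ∈ (trivializationAt F₂ E₂ (b x)).baseSet :=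
    hb.continuousAt.eventually_mem ((trivializationAt F₂ E₂ (b x)).open_baseSet.mem_nhds
      (FiberBundle.mem_baseSet_trivializationAt' (b x)))
  have h' : ∀ᶠ m in 𝓝 x, b m ∈ (trivializationAt F₁ E₁ (b x)).baseSet :=
    hb.continuousAt.eventually_mem ((trivializationAt F₁ E₁ (b x)).open_baseSet.mem_nhds
      (FiberBundle.mem_baseSet_trivializationAt' (b x)))
  filter_upwards [this, h'] with m hm hm'
  simp only [ContinuousLinearMap.inCoordinates, ContinuousLinearMap.comp_apply,
    Trivialization.continuousLinearMapAt_apply]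
  rw [Trivialization.linearMapAt_apply, if_pos hm]
  congr 4
  simp [extend, Trivialization.apply_mk_symm, FiberBundle.mem_baseSet_trivializationAt' (b x)]
  exact Trivialization.symmL_apply _ hm' _

end Bundles

section Manifold

variable {E : Type*} [NormedAddCommGroup E] [NormedSpace ℝ E]
  {H : Type*} [TopologicalSpace H] (I : ModelWithCorners ℝ E H)
  (M : Type*) [TopologicalSpace M] [ChartedSpace H M] [IsManifold I ∞ M]

/-- Smooth vector fields on `M`. -/
abbrev SmoothVectorField := Cₛ^∞⟮I; E, (TangentSpace I : M → Type _)⟯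

/-- Smooth one-forms on `M`. -/
abbrev OneForm := Cₛ^∞⟮I; E →L[ℝ] ℝ, fun x : M => TangentSpace I x →L[ℝ] ℝ⟯

/-- A smooth pseudo-Riemannian metric on `M`: a smooth section of symmetric, nondegenerate bilinear
forms on the tangent spaces. -/
structure PseudoRiemannianMetric where
  toFun : ∀ x : M, TangentSpace I x →L[ℝ] TangentSpace I x →L[ℝ] ℝ
  symm : ∀ x v w, toFun x v w = toFun x w v
  nondegenerate : ∀ x v, (∀ w, toFun x v w = 0) → v = 0
  smooth : ContMDiff I (I.prod 𝓘(ℝ, E →L[ℝ] E →L[ℝ] ℝ)) ∞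
    (fun x => TotalSpace.mk' (E →L[ℝ] E →L[ℝ] ℝ) x (toFun x))

/-- A smooth bivector field `Π` on `M`, given by its anchor map `♯_Π : T*M → TM`, where
`Π(α, β) = β(♯_Π α)`; skew-symmetry of `Π` is the field `skew`. -/
structure BivectorField where
  anchor : ∀ x : M, (TangentSpace I x →L[ℝ] ℝ) →L[ℝ] TangentSpace I x
  skew : ∀ (x : M) (α β : TangentSpace I x →L[ℝ] ℝ), β (anchor x α) = - α (anchor x β)
  smooth : ContMDiff I (I.prod 𝓘(ℝ, (E →L[ℝ] ℝ) →L[ℝ] E)) ∞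
    (fun x => TotalSpace.mk' ((E →L[ℝ] ℝ) →L[ℝ] E)
      (E := fun x : M => (TangentSpace I x →L[ℝ] ℝ) →L[ℝ] TangentSpace I x) x (anchor x))

variable {I M}

/-- The one-form `α` is of class `C^n` at `x`. -/
abbrev FormCD (n : ℕ∞ω) (α : ∀ x : M, TangentSpace I x →L[ℝ] ℝ) (x : M) : Prop :=
  ContMDiffAt I (I.prod 𝓘(ℝ, E →L[ℝ] ℝ)) n (fun y => TotalSpace.mk' (E →L[ℝ] ℝ) y (α y)) x

/-- The one-form `α` is differentiable at `x`. -/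
abbrev FormMD (α : ∀ x : M, TangentSpace I x →L[ℝ] ℝ) (x : M) : Prop :=
  MDifferentiableAt I (I.prod 𝓘(ℝ, E →L[ℝ] ℝ)) (fun y => TotalSpace.mk' (E →L[ℝ] ℝ) y (α y)) x

theorem mdiffAt_pair {n} {α : ∀ x : M, TangentSpace I x →L[ℝ] ℝ} {V : ∀ x : M, TangentSpace I x} {x : M}
   (hα : FormCD n α x) (hV : CMDiffAt n (T% V) x) :
   CMDiffAt n (fun y => α y (V y)) x := by
  have := ContMDiffAt.clm_bundle_apply (b := fun y : M => y) (E₂ := Bundle.Trivial M ℝ) hα hV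
  exact (contMDiffAt_totalSpace.1 this).2

theorem mdiffAt_pair' {α : ∀ x : M, TangentSpace I x →L[ℝ] ℝ} {V : ∀ x : M, TangentSpace I x} {x : M}
   (hα : FormMD α x) (hV : MDiffAt (T% V) x) :
   MDiffAt (fun y => α y (V y)) x := by
  have := MDifferentiableAt.clm_bundle_apply (b := fun y : M => y) (E₂ := Bundle.Trivial M ℝ) hα hV
  exact ((mdifferentiableAt_totalSpace ..).1 this).2

theorem mdiffAt_anchor {n} (P : BivectorField I M) {α : ∀ x : M, TangentSpace I x →L[ℝ] ℝ} {x : M}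
   (hα : FormCD n α x) (hn : n ≤ ∞) :
   CMDiffAt n (T% fun y => P.anchor y (α y)) x := by
  exact ContMDiffAt.clm_bundle_apply (b := fun y : M => y) ((P.smooth x).of_le hn) hα

/-- The one-form `♭_g X = g(X, ·)`. -/
def PseudoRiemannianMetric.flat (g : PseudoRiemannianMetric I M) (X : SmoothVectorField I M) : OneForm I M :=
  ⟨fun x => g.toFun x (X x), by
    exact g.smooth.clm_bundle_apply X.contMDiff⟩

theorem isInvertible_flat [FiniteDimensional ℝ E] (g : PseudoRiemannianMetric I M) (x : M) :
    (g.toFun x).IsInvertible := by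
  let f : E →L[ℝ] E →L[ℝ] ℝ := g.toFun x
  have hf : Function.Injective f.toLinearMap := by
    rw [← LinearMap.ker_eq_bot, LinearMap.ker_eq_bot']
    intro v hv
    exact g.nondegenerate x v fun w => by
      have := congrArg (fun L : E →L[ℝ] ℝ => L w) hv
      exact this
  have hd : Module.finrank ℝ E = Module.finrank ℝ (E →L[ℝ] ℝ) := by
    rw [← (LinearMap.toContinuousLinearMap (𝕜 := ℝ) (E := E) (F' := ℝ)).finrank_eq]
    exact (Subspace.dual_finrank_eq).symm
  let e := (LinearEquiv.ofInjectiveOfFinrankEq f.toLinearMap hf hd).toContinuousLinearEquiv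
  have : f.IsInvertible := ⟨e, by ext v w; rfl⟩
  exact this

/-- The musical isomorphism `♯_g` at the point `x`: the inverse of `v ↦ g_x(v, ·)`, which is
invertible by `isInvertible_flat`. -/
def PseudoRiemannianMetric.sharp (g : PseudoRiemannianMetric I M) (x : M) :
    (TangentSpace I x →L[ℝ] ℝ) →L[ℝ] TangentSpace I x :=
  (g.toFun x).inverse

theorem sharp_smooth [FiniteDimensional ℝ E] (g : PseudoRiemannianMetric I M) :
    ContMDiff I (I.prod 𝓘(ℝ, (E →L[ℝ] ℝ) →L[ℝ] E)) ∞
    (fun x => TotalSpace.mk' ((E →L[ℝ] ℝ) →L[ℝ] E)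
      (E := fun x : M => (TangentSpace I x →L[ℝ] ℝ) →L[ℝ] TangentSpace I x) x (g.sharp x)) := by
  have : CompleteSpace E := FiniteDimensional.complete ℝ E
  intro x₀
  have h := g.smooth x₀
  erw [contMDiffAt_hom_bundle] at h ⊢
  refine ⟨h.1, ?_⟩
  have hx₀ := FiberBundle.mem_baseSet_trivializationAt' (F := E) (E := (TangentSpace I : M → Type _)) x₀
  have hx₀' := FiberBundle.mem_baseSet_trivializationAt' (F := E →L[ℝ] ℝ)
    (E := fun x : M => TangentSpace I x →L[ℝ] ℝ) x₀
  have key : ∀ᶠ x in 𝓝 x₀, x ∈ (trivializationAt E (TangentSpace I : M → Type _) x₀).baseSet ∧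
      x ∈ (trivializationAt (E →L[ℝ] ℝ) (fun x : M => TangentSpace I x →L[ℝ] ℝ) x₀).baseSet :=
    ((Trivialization.open_baseSet _).eventually_mem hx₀).and
      ((Trivialization.open_baseSet _).eventually_mem hx₀')
  have hinv : (ContinuousLinearMap.inCoordinates E (TangentSpace I : M → Type _) (E →L[ℝ] ℝ)
      (fun x : M => TangentSpace I x →L[ℝ] ℝ) x₀ x₀ x₀ x₀ (g.toFun x₀)).IsInvertible := by
    obtain ⟨e, he⟩ := isInvertible_flat g x₀
    rw [ContinuousLinearMap.inCoordinates_eq hx₀ hx₀', ← he]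
    exact ContinuousLinearMap.isInvertible_equiv.comp
      (ContinuousLinearMap.isInvertible_equiv.comp ContinuousLinearMap.isInvertible_equiv)
  have h3 := (hinv.contDiffAt_map_inverse (n := ∞)).contMDiffAt.comp x₀ h.2
  refine h3.congr_of_eventuallyEq ?_
  filter_upwards [key] with x hx
  simp only [Function.comp]
  rw [ContinuousLinearMap.inCoordinates_eq hx.1 hx.2, ContinuousLinearMap.inCoordinates_eq hx.2 hx.1,
    ContinuousLinearMap.inverse_equiv_comp, ContinuousLinearMap.inverse_comp_equiv]
  rfl

theorem FormCD.md {α : ∀ x : M, TangentSpace I x →L[ℝ] ℝ} {x : M} (h : FormCD ∞ α x) : FormMD α x :=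
  h.mdifferentiableAt (by simp)

theorem OneForm.cd (α : OneForm I M) (x : M) : FormCD ∞ (fun y => α y) x := α.contMDiff x

theorem OneForm.md (α : OneForm I M) (x : M) : FormMD (fun y => α y) x := (α.cd x).md

theorem FormMD.anchor (P : BivectorField I M) {α : ∀ x : M, TangentSpace I x →L[ℝ] ℝ} {x : M}
    (h : FormMD α x) : MDiffAt (T% fun y => P.anchor y (α y)) x :=
  MDifferentiableAt.clm_bundle_apply (b := fun y : M => y)
    ((P.smooth x).mdifferentiableAt (by simp)) h

/-- The vector field `♯_Π α`. -/
def BivectorField.sharp (P : BivectorField I M) (α : OneForm I M) : SmoothVectorField I M :=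
  ⟨fun x => P.anchor x (α x), fun x => mdiffAt_anchor P (α.cd x) le_rfl⟩

/-- The function `Π(α, β) = β(♯_Π α)`. -/
def BivectorField.eval (P : BivectorField I M) (α β : OneForm I M) : C^∞⟮I, M; ℝ⟯ :=
  ⟨fun x => β x (P.anchor x (α x)), fun x => mdiffAt_pair (β.cd x) ((P.sharp α).contMDiff x)⟩

/-- `((L_X α)(V))(x) = X(α(V))(x) - α([X, V])(x)` -/
def lieAux (X : ∀ x : M, TangentSpace I x) (α : ∀ x : M, TangentSpace I x →L[ℝ] ℝ)
    (V : ∀ x : M, TangentSpace I x) (x : M) : ℝ :=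
  mvfderiv I (fun y => α y (V y)) x (X x) - α x (mlieBracket I X V x)

variable [FiniteDimensional ℝ E]

theorem lieAux_tensorial {X : ∀ x : M, TangentSpace I x} {α : ∀ x : M, TangentSpace I x →L[ℝ] ℝ}
    {x : M} (hα : FormMD α x) : TensorialAt I E (fun V => lieAux X α V x) x where
  smul {f V} hf hV := by
    have : CompleteSpace E := FiniteDimensional.complete ℝ E
    have h1 : (fun y => α y ((f • V) y)) = f * fun y => α y (V y) := by ext y; simp
    simp only [lieAux, h1, mvfderiv_mul hf (mdiffAt_pair' hα hV), mlieBracket_smul_right hf hV]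
    simp
    ring
  add {V W} hV hW := by
    have : CompleteSpace E := FiniteDimensional.complete ℝ E
    have h1 : (fun y => α y ((V + W) y)) = (fun y => α y (V y)) + fun y => α y (W y) := by ext y; simp
    simp only [lieAux, h1, mvfderiv_add (mdiffAt_pair' hα hV) (mdiffAt_pair' hα hW),
      mlieBracket_add_right hV hW]
    simp
    ring

theorem cd_mvfderiv {f : M → ℝ} {V : ∀ x : M, TangentSpace I x} {x : M} (hf : CMDiffAt ∞ f x)
    (hV : CMDiffAt ∞ (T% V) x) : CMDiffAt ∞ (fun y => mvfderiv I f y (V y)) x := by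
  have h1 := ContMDiffAt.mfderiv_const (m := ∞) hf (by simp)
  have h2 := ContMDiffAt.clm_apply_of_inCoordinates
    (E₁ := (TangentSpace I : M → Type _)) (E₂ := (TangentSpace 𝓘(ℝ, ℝ) : ℝ → Type _))
    (b₁ := fun y : M => y) (b₂ := f) (ϕ := fun y => mfderiv I 𝓘(ℝ, ℝ) f y) h1 hV hf
  rw [contMDiffAt_totalSpace] at h2
  refine h2.2.congr_of_eventuallyEq (Eventually.of_forall fun y => ?_)
  simp only [trivializationAt_model_space_apply]
  rfl

theorem cd_bracket {X V : ∀ x : M, TangentSpace I x} {x : M} (hX : CMDiffAt ∞ (T% X) x)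
    (hV : CMDiffAt ∞ (T% V) x) : CMDiffAt ∞ (T% (mlieBracket I X V)) x := by
  have : CompleteSpace E := FiniteDimensional.complete ℝ E
  have : IsManifold I (minSmoothness ℝ 2) M := by
    rw [minSmoothness_of_isRCLikeNormedField]
    infer_instance
  have : IsManifold I ((⊤ : ℕ∞) + 1) M := by simpa
  exact ContMDiffAt.mlieBracket_vectorField (n := ⊤) (m := ⊤) hX hV (by simp)

theorem formCD_of_apply {α : ∀ x : M, TangentSpace I x →L[ℝ] ℝ} {x : M}
    (h : ∀ V : ∀ x : M, TangentSpace I x, CMDiffAt ∞ (T% V) x → CMDiffAt ∞ (fun y => α y (V y)) x) :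
    FormCD ∞ α x := by
  refine contMDiffAt_hom_of_apply (E₂ := Bundle.Trivial M ℝ) (b := fun y => y) contMDiffAt_id
    fun σ hσ => ?_
  rw [contMDiffAt_totalSpace]
  exact ⟨contMDiffAt_id, h σ hσ⟩

/-- The Lie derivative `L_X α` of a one-form: `(L_X α)(V) = X(α(V)) - α([X, V])`
(see `lieDerivative_apply`). -/
def lieDerivative (X : SmoothVectorField I M) (α : OneForm I M) : OneForm I M :=
  ⟨fun x => TensorialAt.mkHom (fun V => lieAux X α V x) x (lieAux_tensorial (α.md x)), fun x => by
    refine formCD_of_apply fun V hV => ?_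
    have h : CMDiffAt ∞ (fun y => lieAux X α V y) x :=
      (cd_mvfderiv (mdiffAt_pair (α.cd x) hV) (X.contMDiff x)).sub
        (mdiffAt_pair (α.cd x) (cd_bracket (X.contMDiff x) hV))
    refine h.congr_of_eventuallyEq ?_
    filter_upwards [(contMDiffAt_iff_contMDiffAt_nhds (n := 1) (by simp)).1 (hV.of_le (by simp))] with y hy
    exact TensorialAt.mkHom_apply (lieAux_tensorial (α.md y)) (hy.mdifferentiableAt (by simp))⟩

theorem lieDerivative_apply (X : SmoothVectorField I M) (α : OneForm I M)
    {V : ∀ x : M, TangentSpace I x} {x : M} (hV : MDiffAt (T% V) x) :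
    lieDerivative X α x (V x) = mvfderiv I (fun y => α y (V y)) x (X x) - α x (mlieBracket I X V x)  := by
  change TensorialAt.mkHom (fun V => lieAux X α V x) x (lieAux_tensorial (α.md x)) (V x) = _
  rw [TensorialAt.mkHom_apply (lieAux_tensorial (α.md x)) hV, lieAux]

/-- The differential of a smooth function. -/
def differential (f : C^∞⟮I, M; ℝ⟯) : OneForm I M :=
  ⟨fun x => mvfderiv I f x, fun x => formCD_of_apply fun _ hV => cd_mvfderiv (f.contMDiff x) hV⟩

/-- The Koszul bracket `[α, β]_Π = L_{♯α} β - L_{♯β} α - d(Π(α, β))`. -/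
def BivectorField.bracket (P : BivectorField I M) (α β : OneForm I M) : OneForm I M :=
  lieDerivative (P.sharp α) β - lieDerivative (P.sharp β) α - differential (P.eval α β)

theorem sharp_flat (g : PseudoRiemannianMetric I M) (x : M) (v : TangentSpace I x) :
    g.sharp x (g.toFun x v) = v :=
  ((isInvertible_flat g x).inverse_apply_eq).2 rfl

theorem flat_sharp (g : PseudoRiemannianMetric I M) (x : M) (ξ : TangentSpace I x →L[ℝ] ℝ) :
    g.toFun x (g.sharp x ξ) = ξ :=
  (((isInvertible_flat g x).inverse_apply_eq (y := ξ)).1 rfl).symm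

theorem FormMD.sharp (g : PseudoRiemannianMetric I M) {α : ∀ x : M, TangentSpace I x →L[ℝ] ℝ} {x : M}
    (h : FormMD α x) : MDiffAt (T% fun y => g.sharp y (α y)) x :=
  MDifferentiableAt.clm_bundle_apply (b := fun y : M => y)
    ((sharp_smooth g x).mdifferentiableAt (by simp)) h

/-- The vector field `♯_g α`. -/
def PseudoRiemannianMetric.sharpField (g : PseudoRiemannianMetric I M) (α : OneForm I M) :
    SmoothVectorField I M :=
  ⟨fun x => g.sharp x (α x), fun x =>
    ContMDiffAt.clm_bundle_apply (b := fun y : M => y) (sharp_smooth g x) (α.cd x)⟩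

/-- The cometric `g̃(α, β) = g(♯_g α, ♯_g β)` on one-forms. -/
def PseudoRiemannianMetric.cometric (g : PseudoRiemannianMetric I M) (α β : OneForm I M) :
    C^∞⟮I, M; ℝ⟯ :=
  ⟨fun x => g.toFun x (g.sharpField α x) (g.sharpField β x), fun x =>
    mdiffAt_pair ((g.flat (g.sharpField α)).cd x) ((g.sharpField β).contMDiff x)⟩

theorem cometric_eq (g : PseudoRiemannianMetric I M) (α β : OneForm I M) (x : M) :
    g.cometric α β x = α x (g.sharp x (β x)) := by
  change g.toFun x (g.sharp x (α x)) (g.sharp x (β x)) = _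
  rw [flat_sharp]

theorem cometric_symm' (g : PseudoRiemannianMetric I M) (x : M) (ξ ζ : TangentSpace I x →L[ℝ] ℝ) :
    ξ (g.sharp x ζ) = ζ (g.sharp x ξ) := by
  conv_lhs => rw [← flat_sharp g x ξ]
  conv_rhs => rw [← flat_sharp g x ζ]
  exact g.symm _ _ _

/-- The function `[α, β]_Π(A)`, for not necessarily smooth arguments. -/
def brAux (P : BivectorField I M) (α β : ∀ x : M, TangentSpace I x →L[ℝ] ℝ)
    (A : ∀ x : M, TangentSpace I x) (x : M) : ℝ :=
  lieAux (fun y => P.anchor y (α y)) β A x - lieAux (fun y => P.anchor y (β y)) α A x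
    - mvfderiv I (fun y => β y (P.anchor y (α y))) x (A x)

theorem bracket_apply (P : BivectorField I M) (α β : OneForm I M) {A : ∀ x : M, TangentSpace I x}
    {x : M} (hA : MDiffAt (T% A) x) : P.bracket α β x (A x) = brAux P (fun y => α y) (fun y => β y) A x := by
  change lieDerivative (P.sharp α) β x (A x) - lieDerivative (P.sharp β) α x (A x) -
    mvfderiv I (fun y => β y (P.anchor y (α y))) x (A x) = _
  rw [lieDerivative_apply _ _ hA, lieDerivative_apply _ _ hA]
  rfl

theorem brAux_antisymm (P : BivectorField I M) (α β : ∀ x : M, TangentSpace I x →L[ℝ] ℝ)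
    (A : ∀ x : M, TangentSpace I x) (x : M) : brAux P α β A x = - brAux P β α A x := by
  have : (fun y => β y (P.anchor y (α y))) = -fun y => α y (P.anchor y (β y)) := by
    ext y; exact P.skew y _ _
  simp only [brAux, this, mvfderiv_neg]
  simp
  ring

theorem brAux_smul_left (P : BivectorField I M) {α β : ∀ x : M, TangentSpace I x →L[ℝ] ℝ}
    {A : ∀ x : M, TangentSpace I x} {x : M} {f : M → ℝ} (hf : MDiffAt f x) (hα : FormMD α x)
    (hβ : FormMD β x) (hA : MDiffAt (T% A) x) :
    brAux P (f • α) β A x = f x * brAux P α β A x - mvfderiv I f x (P.anchor x (β x)) * α x (A x) := by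
  have : CompleteSpace E := FiniteDimensional.complete ℝ E
  have h1 : (fun y => P.anchor y ((f • α) y)) = f • fun y => P.anchor y (α y) := by ext y; simp
  have h2 : (fun y => (f • α) y (A y)) = f * fun y => α y (A y) := by ext y; simp
  have h3 : (fun y => β y (P.anchor y ((f • α) y))) = f * fun y => β y (P.anchor y (α y)) := by
    ext y; simp
  rw [brAux, h3]
  simp only [brAux, lieAux, h1, h2, mvfderiv_mul hf (mdiffAt_pair' hα hA),
    mvfderiv_mul hf (mdiffAt_pair' hβ (hα.anchor P)), mlieBracket_smul_left hf (hα.anchor P)]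
  simp
  ring

theorem brAux_smul_right (P : BivectorField I M) {α β : ∀ x : M, TangentSpace I x →L[ℝ] ℝ}
    {A : ∀ x : M, TangentSpace I x} {x : M} {f : M → ℝ} (hf : MDiffAt f x) (hα : FormMD α x)
    (hβ : FormMD β x) (hA : MDiffAt (T% A) x) :
    brAux P α (f • β) A x = f x * brAux P α β A x + mvfderiv I f x (P.anchor x (α x)) * β x (A x) := by
  rw [brAux_antisymm, brAux_smul_left P hf hβ hα hA, brAux_antisymm P β α]
  ring

theorem brAux_smul_vec (P : BivectorField I M) {α β : ∀ x : M, TangentSpace I x →L[ℝ] ℝ}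
    {A : ∀ x : M, TangentSpace I x} {x : M} {f : M → ℝ} (hf : MDiffAt f x) (hα : FormMD α x)
    (hβ : FormMD β x) (hA : MDiffAt (T% A) x) :
    brAux P α β (f • A) x = f x * brAux P α β A x := by
  simp only [brAux, (lieAux_tensorial hα).smul hf hA, (lieAux_tensorial hβ).smul hf hA]
  simp
  ring

theorem brAux_add_left (P : BivectorField I M) {α α' β : ∀ x : M, TangentSpace I x →L[ℝ] ℝ}
    {A : ∀ x : M, TangentSpace I x} {x : M} (hα : FormMD α x) (hα' : FormMD α' x)
    (hβ : FormMD β x) (hA : MDiffAt (T% A) x) :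
    brAux P (α + α') β A x = brAux P α β A x + brAux P α' β A x := by
  have : CompleteSpace E := FiniteDimensional.complete ℝ E
  have h1 : (fun y => P.anchor y ((α + α') y)) = (fun y => P.anchor y (α y)) +
    fun y => P.anchor y (α' y) := by ext y; simp
  have h2 : (fun y => (α + α') y (A y)) = (fun y => α y (A y)) + fun y => α' y (A y) := by ext y; simp
  have h3 : (fun y => β y (P.anchor y ((α + α') y))) =
    (fun y => β y (P.anchor y (α y))) + fun y => β y (P.anchor y (α' y)) := by
    ext y; simp
  rw [brAux, h3]
  simp only [brAux, lieAux, h1, h2, mvfderiv_add (mdiffAt_pair' hα hA) (mdiffAt_pair' hα' hA),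
    mvfderiv_add (mdiffAt_pair' hβ (hα.anchor P)) (mdiffAt_pair' hβ (hα'.anchor P)),
    mlieBracket_add_left (hα.anchor P) (hα'.anchor P)]
  simp
  ring

theorem brAux_add_right (P : BivectorField I M) {α β β' : ∀ x : M, TangentSpace I x →L[ℝ] ℝ}
    {A : ∀ x : M, TangentSpace I x} {x : M} (hα : FormMD α x) (hβ : FormMD β x)
    (hβ' : FormMD β' x) (hA : MDiffAt (T% A) x) :
    brAux P α (β + β') A x = brAux P α β A x + brAux P α β' A x := by
  rw [brAux_antisymm, brAux_add_left P hβ hβ' hα hA, brAux_antisymm P β α, brAux_antisymm P β' α]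
  ring

theorem brAux_add_vec (P : BivectorField I M) {α β : ∀ x : M, TangentSpace I x →L[ℝ] ℝ}
    {A A' : ∀ x : M, TangentSpace I x} {x : M} (hα : FormMD α x)
    (hβ : FormMD β x) (hA : MDiffAt (T% A) x) (hA' : MDiffAt (T% A') x) :
    brAux P α β (A + A') x = brAux P α β A x + brAux P α β A' x := by
  simp only [brAux, (lieAux_tensorial hα).add hA hA', (lieAux_tensorial hβ).add hA hA']
  simp
  ring

/-- The right-hand side of the Koszul formula for `2 g̃(D_α β, γ)`. -/
def koszulAux (g : PseudoRiemannianMetric I M) (P : BivectorField I M)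
    (α β γ : ∀ x : M, TangentSpace I x →L[ℝ] ℝ) (x : M) : ℝ :=
  mvfderiv I (fun y => β y (g.sharp y (γ y))) x (P.anchor x (α x))
    + mvfderiv I (fun y => α y (g.sharp y (γ y))) x (P.anchor x (β x))
    - mvfderiv I (fun y => α y (g.sharp y (β y))) x (P.anchor x (γ x))
    + brAux P α β (fun y => g.sharp y (γ y)) x
    - brAux P β γ (fun y => g.sharp y (α y)) x
    - brAux P α γ (fun y => g.sharp y (β y)) x

theorem koszulAux_tensorial (g : PseudoRiemannianMetric I M) (P : BivectorField I M)
    {α β : ∀ x : M, TangentSpace I x →L[ℝ] ℝ} {x : M} (hα : FormMD α x) (hβ : FormMD β x) :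
    TensorialAt I (E →L[ℝ] ℝ) (fun γ => koszulAux g P α β γ x) x where
  smul {f γ} hf hγ := by
    have h1 : (fun y => g.sharp y ((f • γ) y)) = f • fun y => g.sharp y (γ y) := by ext y; simp
    have h2 (ξ : ∀ x : M, TangentSpace I x →L[ℝ] ℝ) :
      (fun y => ξ y (g.sharp y ((f • γ) y))) = f * fun y => ξ y (g.sharp y (γ y)) := by ext y; simp
    have hγ' : FormMD γ x := hγ
    simp only [koszulAux, h1, h2, mvfderiv_mul hf (mdiffAt_pair' hα (hγ'.sharp g)),
      mvfderiv_mul hf (mdiffAt_pair' hβ (hγ'.sharp g)), brAux_smul_vec P hf hα hβ (hγ'.sharp g),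
      brAux_smul_right P hf hα hγ' (hβ.sharp g), brAux_smul_right P hf hβ hγ' (hα.sharp g)]
    simp [cometric_symm' g x (γ x)]
    ring
  add {γ δ} hγ hδ := by
    have h1 : (fun y => g.sharp y ((γ + δ) y)) = (fun y => g.sharp y (γ y)) +
      fun y => g.sharp y (δ y) := by ext y; simp
    have h2 (ξ : ∀ x : M, TangentSpace I x →L[ℝ] ℝ) :
      (fun y => ξ y (g.sharp y ((γ + δ) y))) = (fun y => ξ y (g.sharp y (γ y))) +
        fun y => ξ y (g.sharp y (δ y)) := by ext y; simp
    have hγ' : FormMD γ x := hγ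
    have hδ' : FormMD δ x := hδ
    simp only [koszulAux, h1, h2, mvfderiv_add (mdiffAt_pair' hα (hγ'.sharp g)) (mdiffAt_pair' hα (hδ'.sharp g)),
      mvfderiv_add (mdiffAt_pair' hβ (hγ'.sharp g)) (mdiffAt_pair' hβ (hδ'.sharp g)),
      brAux_add_vec P hα hβ (hγ'.sharp g) (hδ'.sharp g),
      brAux_add_right P hα hγ' hδ' (hβ.sharp g), brAux_add_right P hβ hγ' hδ' (hα.sharp g)]
    simp
    ring

theorem cd_lieAux {X V : ∀ x : M, TangentSpace I x} {α : ∀ x : M, TangentSpace I x →L[ℝ] ℝ} {x : M}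
    (hX : CMDiffAt ∞ (T% X) x) (hα : FormCD ∞ α x) (hV : CMDiffAt ∞ (T% V) x) :
    CMDiffAt ∞ (fun y => lieAux X α V y) x :=
  (cd_mvfderiv (mdiffAt_pair hα hV) hX).sub (mdiffAt_pair hα (cd_bracket hX hV))

theorem FormCD.sharp (g : PseudoRiemannianMetric I M) {α : ∀ x : M, TangentSpace I x →L[ℝ] ℝ} {x : M}
    (h : FormCD ∞ α x) : CMDiffAt ∞ (T% fun y => g.sharp y (α y)) x :=
  ContMDiffAt.clm_bundle_apply (b := fun y : M => y) (sharp_smooth g x) h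

theorem cd_brAux (P : BivectorField I M) {α β : ∀ x : M, TangentSpace I x →L[ℝ] ℝ}
    {A : ∀ x : M, TangentSpace I x} {x : M} (hα : FormCD ∞ α x)
    (hβ : FormCD ∞ β x) (hA : CMDiffAt ∞ (T% A) x) : CMDiffAt ∞ (fun y => brAux P α β A y) x :=
  ((cd_lieAux (mdiffAt_anchor P hα le_rfl) hβ hA).sub
    (cd_lieAux (mdiffAt_anchor P hβ le_rfl) hα hA)).sub
    (cd_mvfderiv (mdiffAt_pair hβ (mdiffAt_anchor P hα le_rfl)) hA)

theorem cd_koszulAux (g : PseudoRiemannianMetric I M) (P : BivectorField I M)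
    {α β γ : ∀ x : M, TangentSpace I x →L[ℝ] ℝ} {x : M} (hα : FormCD ∞ α x) (hβ : FormCD ∞ β x)
    (hγ : FormCD ∞ γ x) : CMDiffAt ∞ (fun y => koszulAux g P α β γ y) x :=
  (((((cd_mvfderiv (mdiffAt_pair hβ (hγ.sharp g)) (mdiffAt_anchor P hα le_rfl)).add
    (cd_mvfderiv (mdiffAt_pair hα (hγ.sharp g)) (mdiffAt_anchor P hβ le_rfl))).sub
    (cd_mvfderiv (mdiffAt_pair hα (hβ.sharp g)) (mdiffAt_anchor P hγ le_rfl))).add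
    (cd_brAux P hα hβ (hγ.sharp g))).sub (cd_brAux P hβ hγ (hα.sharp g))).sub
    (cd_brAux P hα hγ (hβ.sharp g))

/-- The one-form `D_α β` determined by the Koszul formula. -/
def koszulForm (g : PseudoRiemannianMetric I M) (P : BivectorField I M) (α β : OneForm I M) :
    OneForm I M :=
  ⟨fun x => (2⁻¹ : ℝ) • (TensorialAt.mkHom (fun γ => koszulAux g P α β γ x) x
      (koszulAux_tensorial g P (α.md x) (β.md x))).comp (g.toFun x), fun x => by
    refine formCD_of_apply fun V hV => ?_
    have hγ : FormCD ∞ (fun y => g.toFun y (V y)) x :=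
      ContMDiffAt.clm_bundle_apply (b := fun y : M => y) (g.smooth x) hV
    have h : CMDiffAt ∞ (fun y => 2⁻¹ * koszulAux g P α β (fun y => g.toFun y (V y)) y) x :=
      contMDiffAt_const.mul (cd_koszulAux g P (α.cd x) (β.cd x) hγ)
    refine h.congr_of_eventuallyEq ?_
    filter_upwards [(contMDiffAt_iff_contMDiffAt_nhds (n := 1) (by simp)).1
      (hγ.of_le (by simp))] with y hy
    have := TensorialAt.mkHom_apply (koszulAux_tensorial g P (α.md y) (β.md y))
      (hy.mdifferentiableAt (by simp))
    rw [← this]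
    rfl⟩

theorem koszulForm_apply (g : PseudoRiemannianMetric I M) (P : BivectorField I M) (α β : OneForm I M)
    {γ : ∀ x : M, TangentSpace I x →L[ℝ] ℝ} {x : M} (hγ : FormMD γ x) :
    koszulForm g P α β x (g.sharp x (γ x)) = 2⁻¹ * koszulAux g P α β γ x := by
  have := TensorialAt.mkHom_apply (koszulAux_tensorial g P (α.md x) (β.md x)) hγ
  rw [← this]
  change (2⁻¹ : ℝ) * (TensorialAt.mkHom (fun γ => koszulAux g P α β γ x) x
      (koszulAux_tensorial g P (α.md x) (β.md x))) (g.toFun x (g.sharp x (γ x))) = _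
  rw [flat_sharp]

theorem form_ext (g : PseudoRiemannianMetric I M) {α β : OneForm I M}
    (h : ∀ x, ∀ γ : ∀ x : M, TangentSpace I x →L[ℝ] ℝ, FormMD γ x →
      α x (g.sharp x (γ x)) = β x (g.sharp x (γ x))) : α = β := by
  refine ContMDiffSection.ext fun x => ?_
  refine ContinuousLinearMap.ext fun v => ?_
  have := h x (extend (E →L[ℝ] ℝ) (g.toFun x v)) (mdifferentiableAt_extend ..)
  rwa [extend_apply_self, sharp_flat] at this

/-- The product `f α` of a smooth function and a smooth one-form. -/
instance instSMulOneForm : SMul C^∞⟮I, M; ℝ⟯ (OneForm I M) :=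
  ⟨fun f α => ⟨fun x => f x • α x, fun x => ContMDiffAt.smul_section (f.contMDiff x) (α.cd x)⟩⟩

/-- The function `X(f)`. -/
def directional (X : SmoothVectorField I M) (f : C^∞⟮I, M; ℝ⟯) : C^∞⟮I, M; ℝ⟯ :=
  ⟨fun x => mvfderiv I f x (X x), fun x => cd_mvfderiv (f.contMDiff x) (X.contMDiff x)⟩

/-- A contravariant connection `D` on `(M, Π)`: an `ℝ`-bilinear operation `(α, β) ↦ D_α β` on
one-forms with `D_{fα} β = f D_α β` and `D_α (fβ) = f D_α β + (♯_Π α)(f) β`. -/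
structure ContravariantConnection (P : BivectorField I M) where
  deriv : OneForm I M → OneForm I M → OneForm I M
  add_left : ∀ α α' β, deriv (α + α') β = deriv α β + deriv α' β
  smul_left : ∀ (f : C^∞⟮I, M; ℝ⟯) (α β : OneForm I M), deriv (f • α) β = f • deriv α β
  add_right : ∀ α β β', deriv α (β + β') = deriv α β + deriv α β'
  leibniz : ∀ (f : C^∞⟮I, M; ℝ⟯) (α β : OneForm I M),
    deriv α (f • β) = f • deriv α β + directional (P.sharp α) f • β

/-- `D` is torsion-free, and metric with respect to the cometric of `g`. -/
structure IsLeviCivita (g : PseudoRiemannianMetric I M) (P : BivectorField I M)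
    (D : ContravariantConnection P) : Prop where
  torsion_free : ∀ α β, D.deriv α β - D.deriv β α = P.bracket α β
  metric : ∀ α β γ, directional (P.sharp α) (g.cometric β γ) =
    g.cometric (D.deriv α β) γ + g.cometric β (D.deriv α γ)

theorem cometric_coe (g : PseudoRiemannianMetric I M) (α β : OneForm I M) :
    (g.cometric α β : M → ℝ) = fun x => α x (g.sharp x (β x)) :=
  funext fun x => cometric_eq g α β x

theorem koszulAux_add_left (g : PseudoRiemannianMetric I M) (P : BivectorField I M)
    {α α' β γ : ∀ x : M, TangentSpace I x →L[ℝ] ℝ} {x : M} (hα : FormMD α x) (hα' : FormMD α' x)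
    (hβ : FormMD β x) (hγ : FormMD γ x) :
    koszulAux g P (α + α') β γ x = koszulAux g P α β γ x + koszulAux g P α' β γ x := by
  have h1 : (fun y => g.sharp y ((α + α') y)) =
    (fun y => g.sharp y (α y)) + fun y => g.sharp y (α' y) := by ext y; simp
  have h2 (γ : ∀ y : M, TangentSpace I y →L[ℝ] ℝ) : (fun y => (α + α') y (g.sharp y (γ y))) =
    (fun y => α y (g.sharp y (γ y))) + fun y => α' y (g.sharp y (γ y)) := by ext y; simp
  simp only [koszulAux, h1, h2,
    mvfderiv_add (mdiffAt_pair' hα (hγ.sharp g)) (mdiffAt_pair' hα' (hγ.sharp g)),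
    mvfderiv_add (mdiffAt_pair' hα (hβ.sharp g)) (mdiffAt_pair' hα' (hβ.sharp g)),
    brAux_add_vec P hβ hγ (hα.sharp g) (hα'.sharp g),
    brAux_add_left P hα hα' hγ (hβ.sharp g), brAux_add_left P hα hα' hβ (hγ.sharp g)]
  simp
  ring

theorem koszulAux_smul_left (g : PseudoRiemannianMetric I M) (P : BivectorField I M)
    {α β γ : ∀ x : M, TangentSpace I x →L[ℝ] ℝ} {x : M} {f : M → ℝ} (hf : MDiffAt f x)
    (hα : FormMD α x) (hβ : FormMD β x) (hγ : FormMD γ x) :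
    koszulAux g P (f • α) β γ x = f x * koszulAux g P α β γ x := by
  have h1 : (fun y => g.sharp y ((f • α) y)) = f • fun y => g.sharp y (α y) := by ext y; simp
  have h2 (γ : ∀ y : M, TangentSpace I y →L[ℝ] ℝ) : (fun y => (f • α) y (g.sharp y (γ y))) =
    f * (fun y => α y (g.sharp y (γ y))) := by ext y; simp
  simp only [koszulAux, h1, h2, mvfderiv_mul hf (mdiffAt_pair' hα (hγ.sharp g)),
    mvfderiv_mul hf (mdiffAt_pair' hα (hβ.sharp g)),
    brAux_smul_vec P hf hβ hγ (hα.sharp g), brAux_smul_left P hf hα hγ (hβ.sharp g),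
    brAux_smul_left P hf hα hβ (hγ.sharp g)]
  simp
  ring

theorem koszulAux_add_right (g : PseudoRiemannianMetric I M) (P : BivectorField I M)
    {α β β' γ : ∀ x : M, TangentSpace I x →L[ℝ] ℝ} {x : M} (hα : FormMD α x)
    (hβ : FormMD β x) (hβ' : FormMD β' x) (hγ : FormMD γ x) :
    koszulAux g P α (β + β') γ x = koszulAux g P α β γ x + koszulAux g P α β' γ x := by
  have h1 : (fun y => g.sharp y ((β + β') y)) =
    (fun y => g.sharp y (β y)) + fun y => g.sharp y (β' y) := by ext y; simp
  have h2 : (fun y => (β + β') y (g.sharp y (γ y))) =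
    (fun y => β y (g.sharp y (γ y))) + fun y => β' y (g.sharp y (γ y)) := by ext y; simp
  have h5 : (fun y => α y (g.sharp y ((β + β') y))) =
    (fun y => α y (g.sharp y (β y))) + fun y => α y (g.sharp y (β' y)) := by ext y; simp
  simp only [koszulAux, h1, h2, h5,
    mvfderiv_add (mdiffAt_pair' hβ (hγ.sharp g)) (mdiffAt_pair' hβ' (hγ.sharp g)),
    mvfderiv_add (mdiffAt_pair' hα (hβ.sharp g)) (mdiffAt_pair' hα (hβ'.sharp g)),
    brAux_add_vec P hα hγ (hβ.sharp g) (hβ'.sharp g),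
    brAux_add_left P hβ hβ' hγ (hα.sharp g), brAux_add_right P hα hβ hβ' (hγ.sharp g)]
  simp
  ring

theorem koszulAux_smul_right (g : PseudoRiemannianMetric I M) (P : BivectorField I M)
    {α β γ : ∀ x : M, TangentSpace I x →L[ℝ] ℝ} {x : M} {f : M → ℝ} (hf : MDiffAt f x)
    (hα : FormMD α x) (hβ : FormMD β x) (hγ : FormMD γ x) :
    koszulAux g P α (f • β) γ x = f x * koszulAux g P α β γ x +
      2 * (mvfderiv I f x (P.anchor x (α x)) * β x (g.sharp x (γ x))) := by
  have h1 : (fun y => g.sharp y ((f • β) y)) = f • fun y => g.sharp y (β y) := by ext y; simp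
  have h2 : (fun y => (f • β) y (g.sharp y (γ y))) =
    f * (fun y => β y (g.sharp y (γ y))) := by ext y; simp
  have h5 : (fun y => α y (g.sharp y ((f • β) y))) =
    f * (fun y => α y (g.sharp y (β y))) := by ext y; simp
  simp only [koszulAux, h1, h2, h5, mvfderiv_mul hf (mdiffAt_pair' hβ (hγ.sharp g)),
    mvfderiv_mul hf (mdiffAt_pair' hα (hβ.sharp g)),
    brAux_smul_vec P hf hα hγ (hβ.sharp g), brAux_smul_left P hf hβ hγ (hα.sharp g),
    brAux_smul_right P hf hα hβ (hγ.sharp g)]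
  simp [cometric_symm' g x (α x) (β x)]
  ring

/-- The connection given by the Koszul formula. -/
def koszulConnection (g : PseudoRiemannianMetric I M) (P : BivectorField I M) :
    ContravariantConnection P where
  deriv := koszulForm g P
  add_left α α' β := by
    refine form_ext g fun x γ hγ => ?_
    change _ = koszulForm g P α β x _ + koszulForm g P α' β x _
    rw [koszulForm_apply _ _ _ _ hγ, koszulForm_apply _ _ _ _ hγ, koszulForm_apply _ _ _ _ hγ,
      ← mul_add, ← koszulAux_add_left g P (α.md x) (α'.md x) (β.md x) hγ]
    rfl
  smul_left f α β := by
    refine form_ext g fun x γ hγ => ?_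
    change _ = f x * koszulForm g P α β x _
    rw [koszulForm_apply _ _ _ _ hγ, koszulForm_apply _ _ _ _ hγ, mul_left_comm,
      ← koszulAux_smul_left g P f.mdifferentiableAt (α.md x) (β.md x) hγ]
    rfl
  add_right α β β' := by
    refine form_ext g fun x γ hγ => ?_
    change _ = koszulForm g P α β x _ + koszulForm g P α β' x _
    rw [koszulForm_apply _ _ _ _ hγ, koszulForm_apply _ _ _ _ hγ, koszulForm_apply _ _ _ _ hγ,
      ← mul_add, ← koszulAux_add_right g P (α.md x) (β.md x) (β'.md x) hγ]
    rfl
  leibniz f α β := by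
    refine form_ext g fun x γ hγ => ?_
    change _ = f x * koszulForm g P α β x _ +
      mvfderiv I f x (P.anchor x (α x)) * β x (g.sharp x (γ x))
    have h := koszulAux_smul_right g P (f := f) f.mdifferentiableAt (α.md x) (β.md x) hγ
    rw [koszulForm_apply _ _ _ _ hγ, koszulForm_apply _ _ _ _ hγ]
    change 2⁻¹ * koszulAux g P (fun y => α y) ((f : M → ℝ) • fun y => β y) γ x = _
    rw [h]
    ring

theorem koszulConnection_isLeviCivita (g : PseudoRiemannianMetric I M) (P : BivectorField I M) :
    IsLeviCivita g P (koszulConnection g P) where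
  torsion_free α β := by
    refine form_ext g fun x γ hγ => ?_
    change koszulForm g P α β x _ - koszulForm g P β α x _ = _
    rw [koszulForm_apply _ _ _ _ hγ, koszulForm_apply _ _ _ _ hγ, bracket_apply P α β (hγ.sharp g)]
    have h : (fun y => β y (g.sharp y (α y))) = fun y => α y (g.sharp y (β y)) :=
      funext fun y => cometric_symm' g y _ _
    simp only [koszulAux, h]
    rw [brAux_antisymm P (fun y => β y) (fun y => α y)]
    ring
  metric α β γ := by
    ext x
    change mvfderiv I (g.cometric β γ) x (P.anchor x (α x)) =
      g.cometric (koszulForm g P α β) γ x + g.cometric β (koszulForm g P α γ) x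
    rw [cometric_eq, cometric_eq, cometric_coe, cometric_symm' g x (β x),
      koszulForm_apply g P α β (γ.md x), koszulForm_apply g P α γ (β.md x)]
    have h (α β : OneForm I M) : (fun y => β y (g.sharp y (α y))) = fun y => α y (g.sharp y (β y)) :=
      funext fun y => cometric_symm' g y _ _
    simp only [koszulAux, h β γ, h β α, h γ α]
    rw [brAux_antisymm P (fun y => γ y) (fun y => β y)]
    ring

theorem exists_oneForm_eq [T2Space M] {x : M} (ξ : TangentSpace I x →L[ℝ] ℝ) :
    ∃ α : OneForm I M, α x = ξ := by
  obtain ⟨s, hs, h⟩ := exists_contMDiffOn_extend (k := ∞) (I := I) (E →L[ℝ] ℝ)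
    (V := fun x : M => TangentSpace I x →L[ℝ] ℝ) ξ
  obtain ⟨u, hus, hu, hxu⟩ := mem_nhds_iff.1 hs
  obtain ⟨f, -, hf⟩ := (SmoothBumpFunction.nhds_basis_tsupport (I := I) x).mem_iff.1 (hu.mem_nhds hxu)
  refine ⟨⟨_, ContMDiffOn.smul_section_of_tsupport f.contMDiff.contMDiffOn hu hf (h.mono hus)⟩, ?_⟩
  change f x • extend (E := fun x : M => TangentSpace I x →L[ℝ] ℝ) (E →L[ℝ] ℝ) ξ x = ξ
  rw [extend_apply_self, f.eq_one, one_smul]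

theorem isLeviCivita_koszul {g : PseudoRiemannianMetric I M} {P : BivectorField I M}
    {D : ContravariantConnection P} (h : IsLeviCivita g P D) (α β γ : OneForm I M) :
    g.cometric (D.deriv α β) γ + g.cometric (D.deriv α β) γ = directional (P.sharp α) (g.cometric β γ)
      + directional (P.sharp β) (g.cometric α γ) - directional (P.sharp γ) (g.cometric α β)
      + g.cometric (P.bracket α β) γ - g.cometric (P.bracket β γ) α - g.cometric (P.bracket α γ) β := by
  rw [h.metric, h.metric, h.metric, ← h.torsion_free, ← h.torsion_free, ← h.torsion_free]
  have hs (α β : OneForm I M) : g.cometric α β = g.cometric β α := by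
    ext x; exact g.symm _ _ _
  have hd (α β γ : OneForm I M) : g.cometric (α - β) γ = g.cometric α γ - g.cometric β γ := by
    ext x
    change _ = g.cometric α γ x - g.cometric β γ x
    simp [cometric_eq]
  simp only [hd, hs α (D.deriv _ _), hs β (D.deriv _ _)]
  ring

theorem existsUnique_isLeviCivita [T2Space M] (g : PseudoRiemannianMetric I M) (P : BivectorField I M) :
    ∃! D : ContravariantConnection P, IsLeviCivita g P D := by
  refine ⟨koszulConnection g P, koszulConnection_isLeviCivita g P, fun D hD => ?_⟩
  have key : D.deriv = (koszulConnection g P).deriv := by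
    funext α β
    refine form_ext g fun x γ _ => ?_
    obtain ⟨γ', hγ'⟩ := exists_oneForm_eq (γ x)
    have h := (isLeviCivita_koszul hD α β γ').trans
      (isLeviCivita_koszul (koszulConnection_isLeviCivita g P) α β γ').symm
    have h2 := congrArg (fun f : C^∞⟮I, M; ℝ⟯ => f x) h
    have h3 : g.cometric (D.deriv α β) γ' x + g.cometric (D.deriv α β) γ' x =
      g.cometric ((koszulConnection g P).deriv α β) γ' x +
        g.cometric ((koszulConnection g P).deriv α β) γ' x := h2
    rw [cometric_eq, cometric_eq, hγ'] at h3
    linarith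
  cases D
  simp only [koszulConnection] at key ⊢
  subst key
  rfl

/-- The contravariant Levi-Civita connection of `(g̃, Π)`: the unique torsion-free metric
contravariant connection. -/
def leviCivita [T2Space M] (g : PseudoRiemannianMetric I M) (P : BivectorField I M) :
    ContravariantConnection P :=
  (existsUnique_isLeviCivita g P).choose

theorem leviCivita_spec [T2Space M] (g : PseudoRiemannianMetric I M) (P : BivectorField I M) :
    IsLeviCivita g P (leviCivita g P) :=
  (existsUnique_isLeviCivita g P).choose_spec.1

end Manifold

section Geometry

variable {E : Type*} [NormedAddCommGroup E] [NormedSpace ℝ E] [FiniteDimensional ℝ E]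
  {H : Type*} [TopologicalSpace H] {I : ModelWithCorners ℝ E H}
  {M : Type*} [TopologicalSpace M] [ChartedSpace H M] [IsManifold I ∞ M]

/-- The endomorphism field `J` of `T*M` with `Π(α, β) = g̃(J α, β)` for all `β`
(see `cometric_JField`), that is, `J α = ♭_g (♯_Π α)`. -/
def JField (g : PseudoRiemannianMetric I M) (P : BivectorField I M) (α : OneForm I M) :
    OneForm I M :=
  g.flat (P.sharp α)

theorem cometric_JField (g : PseudoRiemannianMetric I M) (P : BivectorField I M)
    (α β : OneForm I M) : g.cometric (JField g P α) β = P.eval α β := by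
  ext x
  rw [cometric_eq, cometric_symm']
  change β x (g.sharp x (g.toFun x (P.anchor x (α x)))) = β x (P.anchor x (α x))
  rw [sharp_flat]

/-- The Poisson bracket `{f, h} = Π(df, dh)` of smooth functions. -/
def BivectorField.functionBracket (P : BivectorField I M) (f h : C^∞⟮I, M; ℝ⟯) : C^∞⟮I, M; ℝ⟯ :=
  P.eval (differential f) (differential h)

/-- `Π` is a Poisson tensor: its bracket on smooth functions satisfies the Jacobi identity. -/
def BivectorField.IsPoisson (P : BivectorField I M) : Prop :=
  ∀ f h k : C^∞⟮I, M; ℝ⟯,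
    P.functionBracket f (P.functionBracket h k) + P.functionBracket h (P.functionBracket k f)
      + P.functionBracket k (P.functionBracket f h) = 0

variable [T2Space M]

/-- The curvature `R(α, β)γ = D_α D_β γ - D_β D_α γ - D_{[α, β]_Π} γ` of the contravariant
Levi-Civita connection. -/
def curvature (g : PseudoRiemannianMetric I M) (P : BivectorField I M) (α β γ : OneForm I M) :
    OneForm I M :=
  (leviCivita g P).deriv α ((leviCivita g P).deriv β γ)
    - (leviCivita g P).deriv β ((leviCivita g P).deriv α γ)
    - (leviCivita g P).deriv (P.bracket α β) γ

/-- The Gram determinant `g̃(α, α) g̃(β, β) - g̃(α, β)²` at `x`. -/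
def gram (g : PseudoRiemannianMetric I M) (α β : OneForm I M) (x : M) : ℝ :=
  g.cometric α α x * g.cometric β β x - g.cometric α β x ^ 2

/-- The sectional curvature `K(α, β) = g̃(R(α, β)β, α) / (g̃(α, α) g̃(β, β) - g̃(α, β)²)` of the
plane spanned by the one-forms `α, β` at the point `x`. -/
def sectionalCurvature (g : PseudoRiemannianMetric I M) (P : BivectorField I M)
    (α β : OneForm I M) (x : M) : ℝ :=
  g.cometric (curvature g P α β β) α x / gram g α β x

end Geometry

section Product

variable {E₁ : Type*} [NormedAddCommGroup E₁] [NormedSpace ℝ E₁]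
  {H₁ : Type*} [TopologicalSpace H₁] {I₁ : ModelWithCorners ℝ E₁ H₁}
  {M₁ : Type*} [TopologicalSpace M₁] [ChartedSpace H₁ M₁] [IsManifold I₁ ∞ M₁]
  {E₂ : Type*} [NormedAddCommGroup E₂] [NormedSpace ℝ E₂]
  {H₂ : Type*} [TopologicalSpace H₂] {I₂ : ModelWithCorners ℝ E₂ H₂}
  {M₂ : Type*} [TopologicalSpace M₂] [ChartedSpace H₂ M₂] [IsManifold I₂ ∞ M₂]

theorem smooth_mfderiv_fst {V : ∀ x : M₁ × M₂, TangentSpace (I₁.prod I₂) x} {x : M₁ × M₂}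
    (hV : CMDiffAt ∞ (T% V) x) :
    ContMDiffAt (I₁.prod I₂) I₁.tangent ∞ (fun y => TotalSpace.mk' E₁ (E := (TangentSpace I₁ : M₁ → Type _))
      y.1 (mfderiv (I₁.prod I₂) I₁ Prod.fst y (V y))) x := by
  have h : ContMDiff (I₁.prod I₂).tangent I₁.tangent ∞ (tangentMap (I₁.prod I₂) I₁ (Prod.fst : M₁ × M₂ → M₁)) :=
    ContMDiff.contMDiff_tangentMap contMDiff_fst (n := ∞) (m := ∞) (by simp)
  exact h.contMDiffAt.comp x hV

theorem smooth_mfderiv_snd {V : ∀ x : M₁ × M₂, TangentSpace (I₁.prod I₂) x} {x : M₁ × M₂}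
    (hV : CMDiffAt ∞ (T% V) x) :
    ContMDiffAt (I₁.prod I₂) I₂.tangent ∞ (fun y => TotalSpace.mk' E₂ (E := (TangentSpace I₂ : M₂ → Type _))
      y.2 (mfderiv (I₁.prod I₂) I₂ Prod.snd y (V y))) x := by
  have h : ContMDiff (I₁.prod I₂).tangent I₂.tangent ∞ (tangentMap (I₁.prod I₂) I₂ (Prod.snd : M₁ × M₂ → M₂)) :=
    ContMDiff.contMDiff_tangentMap contMDiff_snd (n := ∞) (m := ∞) (by simp)
  exact h.contMDiffAt.comp x hV

/-- The differential at `x.1` of the inclusion `M₁ → M₁ × M₂`, `y ↦ (y, x.2)`: the horizontal lift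
of tangent vectors to the point `x`. -/
def inclFst (I₁ : ModelWithCorners ℝ E₁ H₁) (I₂ : ModelWithCorners ℝ E₂ H₂) (x : M₁ × M₂) :
    TangentSpace I₁ x.1 →L[ℝ] TangentSpace (I₁.prod I₂) x :=
  mfderiv I₁ (I₁.prod I₂) (fun y => (y, x.2)) x.1

/-- The differential at `x.2` of the inclusion `M₂ → M₁ × M₂`, `y ↦ (x.1, y)`: the vertical lift
of tangent vectors to the point `x`. -/
def inclSnd (I₁ : ModelWithCorners ℝ E₁ H₁) (I₂ : ModelWithCorners ℝ E₂ H₂) (x : M₁ × M₂) :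
    TangentSpace I₂ x.2 →L[ℝ] TangentSpace (I₁.prod I₂) x :=
  mfderiv I₂ (I₁.prod I₂) (fun y => (x.1, y)) x.2

theorem inclFst_eq (x : M₁ × M₂) : inclFst I₁ I₂ x = ContinuousLinearMap.inl ℝ E₁ E₂ :=
  mfderiv_prod_left

theorem inclSnd_eq (x : M₁ × M₂) : inclSnd I₁ I₂ x = ContinuousLinearMap.inr ℝ E₁ E₂ :=
  mfderiv_prod_right

theorem smooth_incl {V : ∀ x : M₁ × M₂, TangentSpace I₁ x.1} {W : ∀ x : M₁ × M₂, TangentSpace I₂ x.2}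
    {x : M₁ × M₂}
    (hV : ContMDiffAt (I₁.prod I₂) I₁.tangent ∞ (fun y => TotalSpace.mk' E₁ (E := (TangentSpace I₁ : M₁ → Type _))
      y.1 (V y)) x)
    (hW : ContMDiffAt (I₁.prod I₂) I₂.tangent ∞ (fun y => TotalSpace.mk' E₂ (E := (TangentSpace I₂ : M₂ → Type _))
      y.2 (W y)) x) :
    CMDiffAt ∞ (T% fun y => inclFst I₁ I₂ y (V y) + inclSnd I₁ I₂ y (W y)) x := by
  have := (contMDiff_equivTangentBundleProd_symm (n := ∞) (I := I₁) (I' := I₂) (M := M₁) (M' := M₂)).contMDiffAt.comp x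
    (hV.prodMk hW)
  refine this.congr_of_eventuallyEq (Eventually.of_forall fun y => ?_)
  simp only [Function.comp, equivTangentBundleProd]
  congr 1
  have h : ((V y, 0) + (0, W y) : E₁ × E₂) = (V y, W y) := by
    exact Prod.ext (add_zero (V y)) (zero_add (W y))
  rw [inclFst_eq, inclSnd_eq]
  exact h

variable [FiniteDimensional ℝ E₁] [FiniteDimensional ℝ E₂]

/-- The horizontal lift `α^h = π₁^* α`. -/
def hlift (α : OneForm I₁ M₁) : OneForm (I₁.prod I₂) (M₁ × M₂) :=
  ⟨fun x => (α x.1).comp (mfderiv (I₁.prod I₂) I₁ Prod.fst x), fun x => by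
    refine formCD_of_apply fun V hV => ?_
    have := ContMDiffAt.clm_bundle_apply (b := fun y : M₁ × M₂ => y.1) (E₂ := Bundle.Trivial M₁ ℝ)
      ((α.cd x.1).comp x contMDiffAt_fst) (smooth_mfderiv_fst hV)
    exact (contMDiffAt_totalSpace.1 this).2⟩

/-- The vertical lift `α^v = π₂^* α`. -/
def vlift (α : OneForm I₂ M₂) : OneForm (I₁.prod I₂) (M₁ × M₂) :=
  ⟨fun x => (α x.2).comp (mfderiv (I₁.prod I₂) I₂ Prod.snd x), fun x => by
    refine formCD_of_apply fun V hV => ?_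
    have := ContMDiffAt.clm_bundle_apply (b := fun y : M₁ × M₂ => y.2) (E₂ := Bundle.Trivial M₂ ℝ)
      ((α.cd x.2).comp x contMDiffAt_snd) (smooth_mfderiv_snd hV)
    exact (contMDiffAt_totalSpace.1 this).2⟩

/-- The bivector field `Π^ν = Π₁ + ν Π₂` on `M₁ × M₂`, with
`♯_{Π^ν}(α) = (♯_{Π₁} α₁)^h + ν (♯_{Π₂} α₂)^v`, where `α₁`, `α₂` are the restrictions of the covector
`α` to the two factors. -/
def warpedBivector (P₁ : BivectorField I₁ M₁) (P₂ : BivectorField I₂ M₂) (ν : C^∞⟮I₁, M₁; ℝ⟯) :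
    BivectorField (I₁.prod I₂) (M₁ × M₂) where
  anchor x := inclFst I₁ I₂ x ∘L P₁.anchor x.1 ∘L ContinuousLinearMap.precomp ℝ (inclFst I₁ I₂ x)
    + ν x.1 • (inclSnd I₁ I₂ x ∘L P₂.anchor x.2 ∘L
        ContinuousLinearMap.precomp ℝ (inclSnd I₁ I₂ x))
  skew x α β := by
    have h1 := P₁.skew x.1 (α.comp (inclFst I₁ I₂ x)) (β.comp (inclFst I₁ I₂ x))
    have h2 := P₂.skew x.2 (α.comp (inclSnd I₁ I₂ x)) (β.comp (inclSnd I₁ I₂ x))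
    change β (inclFst I₁ I₂ x (P₁.anchor x.1 (α.comp (inclFst I₁ I₂ x))) +
        ν x.1 • inclSnd I₁ I₂ x (P₂.anchor x.2 (α.comp (inclSnd I₁ I₂ x)))) =
      -α (inclFst I₁ I₂ x (P₁.anchor x.1 (β.comp (inclFst I₁ I₂ x))) +
        ν x.1 • inclSnd I₁ I₂ x (P₂.anchor x.2 (β.comp (inclSnd I₁ I₂ x))))
    simp only [ContinuousLinearMap.comp_apply] at h1 h2
    rw [map_add, map_add, map_smul, map_smul, h1, h2, smul_neg, neg_add]
  smooth x := by
    refine contMDiffAt_hom_of_apply (b := fun y : M₁ × M₂ => y) contMDiffAt_id fun σ hσ => ?_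
    have h1 : ContMDiffAt (I₁.prod I₂) (I₁.prod 𝓘(ℝ, E₁ →L[ℝ] ℝ)) ∞
        (fun y : M₁ × M₂ => TotalSpace.mk' (E₁ →L[ℝ] ℝ)
          (E := fun p : M₁ => TangentSpace I₁ p →L[ℝ] ℝ) y.1 ((σ y).comp (inclFst I₁ I₂ y))) x := by
      refine contMDiffAt_hom_of_apply (E₂ := Bundle.Trivial M₁ ℝ) (b := fun y : M₁ × M₂ => y.1)
        contMDiffAt_fst fun τ hτ => ?_
      rw [contMDiffAt_totalSpace]
      refine ⟨contMDiffAt_fst, ?_⟩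
      have hV := smooth_incl (I₁ := I₁) (I₂ := I₂) (V := fun y : M₁ × M₂ => τ y.1) (W := 0)
        (x := x) (hτ.comp x contMDiffAt_fst) ((contMDiff_zeroSection ℝ _ _).comp x contMDiffAt_snd)
      have h := mdiffAt_pair hσ hV
      simpa using h
    have h2 : ContMDiffAt (I₁.prod I₂) (I₂.prod 𝓘(ℝ, E₂ →L[ℝ] ℝ)) ∞
        (fun y : M₁ × M₂ => TotalSpace.mk' (E₂ →L[ℝ] ℝ)
          (E := fun p : M₂ => TangentSpace I₂ p →L[ℝ] ℝ) y.2 ((σ y).comp (inclSnd I₁ I₂ y))) x := by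
      refine contMDiffAt_hom_of_apply (E₂ := Bundle.Trivial M₂ ℝ) (b := fun y : M₁ × M₂ => y.2)
        contMDiffAt_snd fun τ hτ => ?_
      rw [contMDiffAt_totalSpace]
      refine ⟨contMDiffAt_snd, ?_⟩
      have hV := smooth_incl (I₁ := I₁) (I₂ := I₂) (V := 0) (W := fun y : M₁ × M₂ => τ y.2)
        (x := x) ((contMDiff_zeroSection ℝ _ _).comp x contMDiffAt_fst) (hτ.comp x contMDiffAt_snd)
      have h := mdiffAt_pair hσ hV
      simpa using h
    have h3 := ContMDiffAt.clm_bundle_apply (b := fun y : M₁ × M₂ => y.1)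
      ((P₁.smooth x.1).comp x contMDiffAt_fst) h1
    have h4 := ContMDiffAt.clm_bundle_apply (b := fun y : M₁ × M₂ => y.2)
      ((P₂.smooth x.2).comp x contMDiffAt_snd) h2
    have h5 := smooth_incl (I₁ := I₁) (I₂ := I₂) (V := 0) (x := x)
       ((contMDiff_zeroSection ℝ _ _).comp x contMDiffAt_fst) h4
    have h6 := smooth_incl (I₁ := I₁) (I₂ := I₂) (W := 0) (x := x) h3
       ((contMDiff_zeroSection ℝ _ _).comp x contMDiffAt_snd)
    have h7 := h6.add_section (((ν.contMDiff x.1).comp x contMDiffAt_fst).smul_section h5)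
    simpa using h7

/-- The warped metric `π₁^* g₁ + f² π₂^* g₂` on `M₁ × M₂`. -/
def warpedMetric (g₁ : PseudoRiemannianMetric I₁ M₁) (g₂ : PseudoRiemannianMetric I₂ M₂)
    (f : C^∞⟮I₁, M₁; ℝ⟯) (hf : ∀ p, 0 < f p) :
    PseudoRiemannianMetric (I₁.prod I₂) (M₁ × M₂) where
  toFun x := ContinuousLinearMap.precomp ℝ (mfderiv (I₁.prod I₂) I₁ Prod.fst x) ∘L
        g₁.toFun x.1 ∘L mfderiv (I₁.prod I₂) I₁ Prod.fst x
      + f x.1 ^ 2 • (ContinuousLinearMap.precomp ℝ (mfderiv (I₁.prod I₂) I₂ Prod.snd x) ∘L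
        g₂.toFun x.2 ∘L mfderiv (I₁.prod I₂) I₂ Prod.snd x)
  symm x v w := by
    change g₁.toFun x.1 _ _ + f x.1 ^ 2 * g₂.toFun x.2 _ _ =
      g₁.toFun x.1 _ _ + f x.1 ^ 2 * g₂.toFun x.2 _ _
    rw [g₁.symm, g₂.symm]
  nondegenerate x v hv := by
    have key (w : TangentSpace (I₁.prod I₂) x) : g₁.toFun x.1 v.1 w.1 +
        f x.1 ^ 2 * g₂.toFun x.2 v.2 w.2 = 0 := by
      have h := hv w
      change g₁.toFun x.1 (mfderiv (I₁.prod I₂) I₁ Prod.fst x v)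
          (mfderiv (I₁.prod I₂) I₁ Prod.fst x w) + f x.1 ^ 2 *
        g₂.toFun x.2 (mfderiv (I₁.prod I₂) I₂ Prod.snd x v)
          (mfderiv (I₁.prod I₂) I₂ Prod.snd x w) = 0 at h
      rw [mfderiv_fst, mfderiv_snd] at h
      exact h
    have h1 : v.1 = 0 := g₁.nondegenerate x.1 v.1 fun w => by
      have h := key (w, 0)
      have h' : g₂.toFun x.2 v.2 0 = 0 := map_zero _
      change g₁.toFun x.1 v.1 w + f x.1 ^ 2 * g₂.toFun x.2 v.2 0 = 0 at h
      rwa [h', mul_zero, add_zero] at h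
    have h2 : v.2 = 0 := g₂.nondegenerate x.2 v.2 fun w => by
      have h := key (0, w)
      have h' : g₁.toFun x.1 v.1 0 = 0 := map_zero _
      change g₁.toFun x.1 v.1 0 + f x.1 ^ 2 * g₂.toFun x.2 v.2 w = 0 at h
      rw [h', zero_add] at h
      exact (mul_eq_zero.1 h).resolve_left (pow_pos (hf x.1) 2).ne'
    exact Prod.ext h1 h2
  smooth x := by
    refine contMDiffAt_hom_of_apply (b := fun y : M₁ × M₂ => y) contMDiffAt_id fun σ hσ => ?_
    refine formCD_of_apply fun V hV => ?_
    have h1 := ContMDiffAt.clm_bundle_apply₂ (b := fun y : M₁ × M₂ => y.1)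
      (E₃ := Bundle.Trivial M₁ ℝ)
      ((g₁.smooth x.1).comp x contMDiffAt_fst) (smooth_mfderiv_fst hσ) (smooth_mfderiv_fst hV)
    have h2 := ContMDiffAt.clm_bundle_apply₂ (b := fun y : M₁ × M₂ => y.2)
      (E₃ := Bundle.Trivial M₂ ℝ)
      ((g₂.smooth x.2).comp x contMDiffAt_snd) (smooth_mfderiv_snd hσ) (smooth_mfderiv_snd hV)
    exact (contMDiffAt_totalSpace.1 h1).2.add
      ((((f.contMDiff x.1).comp x contMDiffAt_fst).pow 2).mul (contMDiffAt_totalSpace.1 h2).2)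

end Product

end

end PoissonWarped

open PoissonWarped
open scoped Manifold ContDiff

namespace PoissonWarped
open Bundle Set Filter FiberBundle VectorField
open scoped Manifold ContDiff Topology

noncomputable section

set_option linter.unusedSectionVars false

section LieBracket

variable {E : Type*} [NormedAddCommGroup E] [NormedSpace ℝ E] [FiniteDimensional ℝ E]
  {H : Type*} [TopologicalSpace H] {I : ModelWithCorners ℝ E H}
  {M : Type*} [TopologicalSpace M] [ChartedSpace H M] [IsManifold I ∞ M]

theorem eventually_md {V : ∀ x : M, TangentSpace I x} {x : M} (hV : CMDiffAt ∞ (T% V) x) :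
    ∀ᶠ y in 𝓝 x, MDiffAt (T% V) y := by
  filter_upwards [(contMDiffAt_iff_contMDiffAt_nhds (n := 1) (by simp)).1 (hV.of_le (by simp))]
    with y hy using hy.mdifferentiableAt (by simp)

/-- The Lie bracket acts on functions as the commutator of derivations. -/
theorem mvfderiv_mlieBracket {φ : M → ℝ} {X Y : ∀ x : M, TangentSpace I x} {x : M}
    (hφ : CMDiffAt ∞ φ x) (hX : CMDiffAt ∞ (T% X) x) (hY : CMDiffAt ∞ (T% Y) x) :
    mvfderiv I φ x (mlieBracket I X Y x) =
      mvfderiv I (fun y => mvfderiv I φ y (Y y)) x (X x) -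
      mvfderiv I (fun y => mvfderiv I φ y (X y)) x (Y x) := by
  have : CompleteSpace E := FiniteDimensional.complete ℝ E
  rcases subsingleton_or_nontrivial E with hE | hE
  · have h0 : ∀ v : TangentSpace I x, v = 0 := fun v => Subsingleton.elim (α := E) v 0
    rw [h0 (mlieBracket I X Y x), h0 (X x), h0 (Y x)]
    simp
  obtain ⟨z, hz⟩ := exists_ne (0 : E)
  let Z : ∀ y : M, TangentSpace I y := extend E (show TangentSpace I x from z)
  have hZ : CMDiffAt ∞ (T% Z) x := contMDiffAt_extend I E _
  have hZx : Z x = z := extend_apply_self ..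
  have hIM : IsManifold I (minSmoothness ℝ 3) M := by
    rw [minSmoothness_of_isRCLikeNormedField]
    exact IsManifold.of_le (n := ∞) (by exact WithTop.coe_le_coe.2 (le_top : (3 : ℕ∞) ≤ ⊤))
  have h2 : minSmoothness ℝ 2 ≤ ∞ := by
    rw [minSmoothness_of_isRCLikeNormedField]; exact WithTop.coe_le_coe.2 (le_top : (2 : ℕ∞) ≤ ⊤)
  have hφZ : CMDiffAt ∞ (T% (φ • Z)) x := hφ.smul_section hZ
  have J1 := leibniz_identity_mlieBracket_apply (I := I) (hX.of_le h2) (hY.of_le h2)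
    (hφZ.of_le h2)
  have J2 := leibniz_identity_mlieBracket_apply (I := I) (hX.of_le h2) (hY.of_le h2)
    (hZ.of_le h2)
  have hφ' : ∀ᶠ y in 𝓝 x, MDiffAt φ y := by
    filter_upwards [(contMDiffAt_iff_contMDiffAt_nhds (n := 1) (by simp)).1 (hφ.of_le (by simp))]
      with y hy using hy.mdifferentiableAt (by simp)
  have key (W : ∀ y : M, TangentSpace I y) : mlieBracket I W (φ • Z) =ᶠ[𝓝 x]
      (fun y => mvfderiv I φ y (W y)) • Z + φ • mlieBracket I W Z := by
    filter_upwards [hφ', eventually_md hZ] with y h1 h2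
    exact mlieBracket_smul_right h1 h2
  have md {f : M → ℝ} (hf : CMDiffAt ∞ f x) : MDiffAt f x := hf.mdifferentiableAt (by simp)
  have mdV {V : ∀ y : M, TangentSpace I y} (hV : CMDiffAt ∞ (T% V) x) : MDiffAt (T% V) x :=
    hV.mdifferentiableAt (by simp)
  have expand {V W : ∀ y : M, TangentSpace I y} (hV : CMDiffAt ∞ (T% V) x)
      (hW : CMDiffAt ∞ (T% W) x) : mlieBracket I V (mlieBracket I W (φ • Z)) x =
      mvfderiv I (fun y => mvfderiv I φ y (W y)) x (V x) • Z x +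
      mvfderiv I φ x (W x) • mlieBracket I V Z x + (mvfderiv I φ x (V x) • mlieBracket I W Z x +
      φ x • mlieBracket I V (mlieBracket I W Z) x) := by
    rw [EventuallyEq.mlieBracket_vectorField_eq (EventuallyEq.refl _ V) (key W),
      mlieBracket_add_right (mdV ((cd_mvfderiv hφ hW).smul_section hZ))
        (mdV (hφ.smul_section (cd_bracket hW hZ))),
      mlieBracket_smul_right (md (cd_mvfderiv hφ hW)) (mdV hZ),
      mlieBracket_smul_right (md hφ) (mdV (cd_bracket hW hZ))]
  rw [expand hX hY, expand hY hX, (key _).self_of_nhds] at J1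
  simp only [Pi.add_apply, Pi.smul_apply'] at J1
  rw [J2] at J1
  have J3 : (mvfderiv I (fun y => mvfderiv I φ y (Y y)) x (X x) -
      mvfderiv I (fun y => mvfderiv I φ y (X y)) x (Y x) -
      mvfderiv I φ x (mlieBracket I X Y x)) • Z x = 0 := by
    have module_identity (z u v w w' : E) (a b c d e k : ℝ)
        (h : a • z + b • u + (c • v + k • (w + w')) =
          d • z + k • w + (e • z + c • v + (b • u + k • w'))) : (a - e - d) • z = 0 := by
      rw [← sub_eq_zero.2 h]
      module
    exact module_identity _ _ _ _ _ _ _ _ _ _ _ J1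
  have := (smul_eq_zero.1 J3).resolve_right (by rw [hZx]; exact hz)
  linarith

/-- Every covector is the differential of a function which is smooth near the base point. -/
theorem exists_mvfderiv_eq (x : M) (ξ : TangentSpace I x →L[ℝ] ℝ) :
    ∃ φ : M → ℝ, CMDiffAt ∞ φ x ∧ mvfderiv I φ x = ξ := by
  let ξ' : E →L[ℝ] ℝ := ξ
  refine ⟨ξ' ∘ extChartAt I x, ξ'.contMDiff.contMDiffAt.comp x contMDiffAt_extChartAt, ?_⟩
  rw [mvfderiv_comp x ξ'.mdifferentiableAt
    (contMDiffAt_extChartAt.mdifferentiableAt (n := ∞) (by simp)), mfderiv_extChartAt_self]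
  ext v
  simp [mvfderiv]
  rfl

end LieBracket

section Related

variable {E : Type*} [NormedAddCommGroup E] [NormedSpace ℝ E] [FiniteDimensional ℝ E]
  {H : Type*} [TopologicalSpace H] {I : ModelWithCorners ℝ E H}
  {M : Type*} [TopologicalSpace M] [ChartedSpace H M] [IsManifold I ∞ M]
  {E' : Type*} [NormedAddCommGroup E'] [NormedSpace ℝ E'] [FiniteDimensional ℝ E']
  {H' : Type*} [TopologicalSpace H'] {I' : ModelWithCorners ℝ E' H'}
  {N : Type*} [TopologicalSpace N] [ChartedSpace H' N] [IsManifold I' ∞ N]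

/-- Lie brackets of related vector fields are related. -/
theorem mfderiv_mlieBracket_of_related {F : N → M} {X Y : ∀ y : N, TangentSpace I' y}
    {X₁ Y₁ : ∀ x : M, TangentSpace I x} {y : N} (hF : CMDiff ∞ F)
    (hX : CMDiffAt ∞ (T% X) y) (hY : CMDiffAt ∞ (T% Y) y)
    (hX₁ : CMDiffAt ∞ (T% X₁) (F y)) (hY₁ : CMDiffAt ∞ (T% Y₁) (F y))
    (hXr : ∀ z, mfderiv I' I F z (X z) = X₁ (F z)) (hYr : ∀ z, mfderiv I' I F z (Y z) = Y₁ (F z)) :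
    mfderiv I' I F y (mlieBracket I' X Y y) = mlieBracket I X₁ Y₁ (F y) := by
  have mdF (z : N) : MDiffAt F z := (hF z).mdifferentiableAt (by simp)
  suffices h : ∀ ξ : TangentSpace I (F y) →L[ℝ] ℝ,
      ξ (mfderiv I' I F y (mlieBracket I' X Y y)) = ξ (mlieBracket I X₁ Y₁ (F y)) from
    (SeparatingDual.eq_iff_forall_dual_eq (R := ℝ) (V := E)).2 h
  intro ξ
  obtain ⟨φ, hφ, rfl⟩ := exists_mvfderiv_eq (I := I) (F y) ξ
  have hφ' : ∀ᶠ x in 𝓝 (F y), MDiffAt φ x := by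
    filter_upwards [(contMDiffAt_iff_contMDiffAt_nhds (n := 1) (by simp)).1 (hφ.of_le (by simp))]
      with y hy using hy.mdifferentiableAt (by simp)
  have aux {V : ∀ y : N, TangentSpace I' y} {V₁ : ∀ x : M, TangentSpace I x}
      (hr : ∀ z, mfderiv I' I F z (V z) = V₁ (F z)) :
      (fun z => mvfderiv I' (φ ∘ F) z (V z)) =ᶠ[𝓝 y] (fun x => mvfderiv I φ x (V₁ x)) ∘ F := by
    filter_upwards [(hF y).continuousAt.eventually hφ'] with z hz
    rw [mvfderiv_comp_apply z hz (mdF z), hr]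
    rfl
  have aux2 {f g : N → ℝ} (h : f =ᶠ[𝓝 y] g) : mvfderiv I' f y = mvfderiv I' g y := by
    simp only [mvfderiv, h.mfderiv_eq]
    rfl
  rw [mvfderiv_mlieBracket hφ hX₁ hY₁, ← mvfderiv_comp_apply y hφ'.self_of_nhds (mdF y),
    mvfderiv_mlieBracket (hφ.comp y (hF y)) hX hY, aux2 (aux hXr), aux2 (aux hYr),
    mvfderiv_comp_apply y ((cd_mvfderiv hφ hX₁).mdifferentiableAt (by simp)) (mdF y),
    mvfderiv_comp_apply y ((cd_mvfderiv hφ hY₁).mdifferentiableAt (by simp)) (mdF y), hXr, hYr]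

end Related

section LieDerivative

variable {E : Type*} [NormedAddCommGroup E] [NormedSpace ℝ E] [FiniteDimensional ℝ E]
  {H : Type*} [TopologicalSpace H] {I : ModelWithCorners ℝ E H}
  {M : Type*} [TopologicalSpace M] [ChartedSpace H M] [IsManifold I ∞ M]

theorem lieDerivative_zero (α : OneForm I M) : lieDerivative 0 α = 0 := by
  refine ContMDiffSection.ext fun x => ContinuousLinearMap.ext fun v => ?_
  have h := lieDerivative_apply 0 α (mdifferentiableAt_extend (x := x) I E v)
  rw [extend_apply_self] at h
  rw [h]
  change mvfderiv I _ x 0 - α x (mlieBracket I 0 _ x) = 0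
  simp

theorem lieDerivative_smul_apply {X Y : SmoothVectorField I M} {h : C^∞⟮I, M; ℝ⟯}
    (hX : ∀ x, X x = h x • Y x) (α : OneForm I M) (x : M) (v : TangentSpace I x) :
    lieDerivative X α x v =
      h x * lieDerivative Y α x v + α x (Y x) * mvfderiv I h x v := by
  have : CompleteSpace E := FiniteDimensional.complete ℝ E
  have hV := mdifferentiableAt_extend (x := x) I E v
  have h1 := lieDerivative_apply X α hV
  have h2 := lieDerivative_apply Y α hV
  have hXY : (X : ∀ x, TangentSpace I x) = (h : M → ℝ) • (Y : ∀ x, TangentSpace I x) := funext hX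
  rw [hXY, mlieBracket_smul_left h.mdifferentiableAt
    ((Y.contMDiff x).mdifferentiableAt (by simp))] at h1
  simp only [extend_apply_self] at h1 h2
  rw [h1, h2]
  simp
  ring

end LieDerivative

section Product

variable {E₁ : Type*} [NormedAddCommGroup E₁] [NormedSpace ℝ E₁]
  {H₁ : Type*} [TopologicalSpace H₁] {I₁ : ModelWithCorners ℝ E₁ H₁}
  {M₁ : Type*} [TopologicalSpace M₁] [ChartedSpace H₁ M₁] [IsManifold I₁ ∞ M₁]
  {E₂ : Type*} [NormedAddCommGroup E₂] [NormedSpace ℝ E₂]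
  {H₂ : Type*} [TopologicalSpace H₂] {I₂ : ModelWithCorners ℝ E₂ H₂}
  {M₂ : Type*} [TopologicalSpace M₂] [ChartedSpace H₂ M₂] [IsManifold I₂ ∞ M₂]

/-- The function `φ ∘ π₁`. -/
def funFst (I₂ : ModelWithCorners ℝ E₂ H₂) (M₂ : Type*) [TopologicalSpace M₂] [ChartedSpace H₂ M₂]
    (φ : C^∞⟮I₁, M₁; ℝ⟯) : C^∞⟮I₁.prod I₂, M₁ × M₂; ℝ⟯ :=
  ⟨fun x => φ x.1, φ.contMDiff.comp contMDiff_fst⟩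

/-- The function `φ ∘ π₂`. -/
def funSnd (I₁ : ModelWithCorners ℝ E₁ H₁) (M₁ : Type*) [TopologicalSpace M₁] [ChartedSpace H₁ M₁]
    (φ : C^∞⟮I₂, M₂; ℝ⟯) : C^∞⟮I₁.prod I₂, M₁ × M₂; ℝ⟯ :=
  ⟨fun x => φ x.2, φ.contMDiff.comp contMDiff_snd⟩

theorem mfderiv_fst_inclFst (x : M₁ × M₂) (u : TangentSpace I₁ x.1) :
    mfderiv (I₁.prod I₂) I₁ Prod.fst x (inclFst I₁ I₂ x u) = u := by
  rw [mfderiv_fst, inclFst_eq]; rfl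

theorem mfderiv_fst_inclSnd (x : M₁ × M₂) (w : TangentSpace I₂ x.2) :
    mfderiv (I₁.prod I₂) I₁ Prod.fst x (inclSnd I₁ I₂ x w) = 0 := by
  rw [mfderiv_fst, inclSnd_eq]; rfl

theorem mfderiv_snd_inclFst (x : M₁ × M₂) (u : TangentSpace I₁ x.1) :
    mfderiv (I₁.prod I₂) I₂ Prod.snd x (inclFst I₁ I₂ x u) = 0 := by
  rw [mfderiv_snd, inclFst_eq]; rfl

theorem mfderiv_snd_inclSnd (x : M₁ × M₂) (w : TangentSpace I₂ x.2) :
    mfderiv (I₁.prod I₂) I₂ Prod.snd x (inclSnd I₁ I₂ x w) = w := by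
  rw [mfderiv_snd, inclSnd_eq]; rfl

theorem inclFst_add_inclSnd (x : M₁ × M₂) (v : TangentSpace (I₁.prod I₂) x) :
    inclFst I₁ I₂ x (mfderiv (I₁.prod I₂) I₁ Prod.fst x v) +
      inclSnd I₁ I₂ x (mfderiv (I₁.prod I₂) I₂ Prod.snd x v) = v := by
  rw [mfderiv_fst, mfderiv_snd, inclFst_eq, inclSnd_eq]
  exact Prod.ext (add_zero (v.1 : E₁)) (zero_add (v.2 : E₂))

theorem mvfderiv_funFst (φ : C^∞⟮I₁, M₁; ℝ⟯) (x : M₁ × M₂) (v : TangentSpace (I₁.prod I₂) x) :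
    mvfderiv (I₁.prod I₂) (funFst I₂ M₂ φ) x v =
      mvfderiv I₁ φ x.1 (mfderiv (I₁.prod I₂) I₁ Prod.fst x v) :=
  mvfderiv_comp_apply x φ.mdifferentiableAt mdifferentiableAt_fst v

theorem mvfderiv_funSnd (φ : C^∞⟮I₂, M₂; ℝ⟯) (x : M₁ × M₂) (v : TangentSpace (I₁.prod I₂) x) :
    mvfderiv (I₁.prod I₂) (funSnd I₁ M₁ φ) x v =
      mvfderiv I₂ φ x.2 (mfderiv (I₁.prod I₂) I₂ Prod.snd x v) :=
  mvfderiv_comp_apply x φ.mdifferentiableAt mdifferentiableAt_snd v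

/-- The vertical lift of a vector field. -/
def vliftField (I₁ : ModelWithCorners ℝ E₁ H₁) (M₁ : Type*) [TopologicalSpace M₁]
    [ChartedSpace H₁ M₁] [IsManifold I₁ ∞ M₁] (Z : SmoothVectorField I₂ M₂) :
    SmoothVectorField (I₁.prod I₂) (M₁ × M₂) :=
  ⟨fun x => inclSnd I₁ I₂ x (Z x.2), fun x => by
    have := smooth_incl (I₁ := I₁) (I₂ := I₂) (V := 0) (W := fun y : M₁ × M₂ => Z y.2) (x := x)
      ((contMDiff_zeroSection ℝ _ _).comp x contMDiffAt_fst)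
      ((Z.contMDiff x.2).comp x contMDiffAt_snd)
    simpa using this⟩

/-- The vector field extending `inclFst u + inclSnd w` near a point by lifting local extensions. -/
theorem exists_related_extension (x : M₁ × M₂) (v : TangentSpace (I₁.prod I₂) x) :
    ∃ (V : ∀ y : M₁ × M₂, TangentSpace (I₁.prod I₂) y) (V₁ : ∀ y : M₁, TangentSpace I₁ y)
      (V₂ : ∀ y : M₂, TangentSpace I₂ y), V x = v ∧ CMDiffAt ∞ (T% V) x ∧
      CMDiffAt ∞ (T% V₁) x.1 ∧ CMDiffAt ∞ (T% V₂) x.2 ∧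
      (∀ y, mfderiv (I₁.prod I₂) I₁ Prod.fst y (V y) = V₁ y.1) ∧
      ∀ y, mfderiv (I₁.prod I₂) I₂ Prod.snd y (V y) = V₂ y.2 := by
  have h1 := contMDiffAt_extend I₁ E₁ (k := ∞) (mfderiv (I₁.prod I₂) I₁ Prod.fst x v)
  have h2 := contMDiffAt_extend I₂ E₂ (k := ∞) (mfderiv (I₁.prod I₂) I₂ Prod.snd x v)
  refine ⟨fun y => inclFst I₁ I₂ y (extend E₁ (mfderiv (I₁.prod I₂) I₁ Prod.fst x v) y.1) +
    inclSnd I₁ I₂ y (extend E₂ (mfderiv (I₁.prod I₂) I₂ Prod.snd x v) y.2), _, _, ?_,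
    smooth_incl (h1.comp x contMDiffAt_fst) (h2.comp x contMDiffAt_snd), h1, h2, fun y => ?_,
    fun y => ?_⟩
  · simp only [extend_apply_self, inclFst_add_inclSnd]
  · rw [map_add, mfderiv_fst_inclFst, mfderiv_fst_inclSnd, add_zero]
  · rw [map_add, mfderiv_snd_inclFst, mfderiv_snd_inclSnd, zero_add]

variable [FiniteDimensional ℝ E₁] [FiniteDimensional ℝ E₂]

theorem hlift_apply (α : OneForm I₁ M₁) (x : M₁ × M₂) (v : TangentSpace (I₁.prod I₂) x) :
    (hlift α : OneForm (I₁.prod I₂) (M₁ × M₂)) x v =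
      α x.1 (mfderiv (I₁.prod I₂) I₁ Prod.fst x v) := rfl

theorem vlift_apply (α : OneForm I₂ M₂) (x : M₁ × M₂) (v : TangentSpace (I₁.prod I₂) x) :
    (vlift α : OneForm (I₁.prod I₂) (M₁ × M₂)) x v =
      α x.2 (mfderiv (I₁.prod I₂) I₂ Prod.snd x v) := rfl

theorem hlift_zero : hlift (0 : OneForm I₁ M₁) = (0 : OneForm (I₁.prod I₂) (M₁ × M₂)) := rfl

theorem vlift_zero : vlift (0 : OneForm I₂ M₂) = (0 : OneForm (I₁.prod I₂) (M₁ × M₂)) := rfl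

theorem lieDerivative_hlift {X : SmoothVectorField (I₁.prod I₂) (M₁ × M₂)}
    {X₁ : SmoothVectorField I₁ M₁}
    (h : ∀ y, mfderiv (I₁.prod I₂) I₁ Prod.fst y (X y) = X₁ y.1) (β : OneForm I₁ M₁) :
    lieDerivative X (hlift β) = hlift (lieDerivative X₁ β) := by
  refine ContMDiffSection.ext fun x => ContinuousLinearMap.ext fun v => ?_
  obtain ⟨V, V₁, V₂, rfl, hV, hV₁, -, hr₁, -⟩ := exists_related_extension x v
  have hβ : (fun y => (hlift β : OneForm (I₁.prod I₂) (M₁ × M₂)) y (V y)) =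
      (fun y => β y (V₁ y)) ∘ Prod.fst := by
    ext y
    rw [hlift_apply, hr₁]
    rfl
  rw [hlift_apply, hr₁, lieDerivative_apply _ _ (hV.mdifferentiableAt (by simp)),
    lieDerivative_apply _ _ (hV₁.mdifferentiableAt (by simp)), hlift_apply,
    mfderiv_mlieBracket_of_related contMDiff_fst (X.contMDiff x) hV (X₁.contMDiff x.1) hV₁ h hr₁,
    hβ, mvfderiv_comp_apply x ((mdiffAt_pair (β.cd x.1) hV₁).mdifferentiableAt (by simp))
      mdifferentiableAt_fst, h]

theorem lieDerivative_vlift {X : SmoothVectorField (I₁.prod I₂) (M₁ × M₂)}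
    {X₂ : SmoothVectorField I₂ M₂}
    (h : ∀ y, mfderiv (I₁.prod I₂) I₂ Prod.snd y (X y) = X₂ y.2) (β : OneForm I₂ M₂) :
    lieDerivative X (vlift β) = vlift (lieDerivative X₂ β) := by
  refine ContMDiffSection.ext fun x => ContinuousLinearMap.ext fun v => ?_
  obtain ⟨V, V₁, V₂, rfl, hV, -, hV₂, -, hr₂⟩ := exists_related_extension x v
  have hβ : (fun y => (vlift β : OneForm (I₁.prod I₂) (M₁ × M₂)) y (V y)) =
      (fun y => β y (V₂ y)) ∘ Prod.snd := by
    ext y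
    rw [vlift_apply, hr₂]
    rfl
  rw [vlift_apply, hr₂, lieDerivative_apply _ _ (hV.mdifferentiableAt (by simp)),
    lieDerivative_apply _ _ (hV₂.mdifferentiableAt (by simp)), vlift_apply,
    mfderiv_mlieBracket_of_related contMDiff_snd (X.contMDiff x) hV (X₂.contMDiff x.2) hV₂ h hr₂,
    hβ, mvfderiv_comp_apply x ((mdiffAt_pair (β.cd x.2) hV₂).mdifferentiableAt (by simp))
      mdifferentiableAt_snd, h]

variable (g₁ : PseudoRiemannianMetric I₁ M₁) (g₂ : PseudoRiemannianMetric I₂ M₂)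
  (P₁ : BivectorField I₁ M₁) (P₂ : BivectorField I₂ M₂) (f ν : C^∞⟮I₁, M₁; ℝ⟯) (hf : ∀ p, 0 < f p)

theorem warpedMetric_apply (x : M₁ × M₂) (v w : TangentSpace (I₁.prod I₂) x) :
    (warpedMetric g₁ g₂ f hf).toFun x v w =
      g₁.toFun x.1 (mfderiv (I₁.prod I₂) I₁ Prod.fst x v) (mfderiv (I₁.prod I₂) I₁ Prod.fst x w) +
      f x.1 ^ 2 * g₂.toFun x.2 (mfderiv (I₁.prod I₂) I₂ Prod.snd x v)
        (mfderiv (I₁.prod I₂) I₂ Prod.snd x w) := rfl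

theorem sharp_hlift (α : OneForm I₁ M₁) (x : M₁ × M₂) :
    (warpedMetric g₁ g₂ f hf).sharp x (hlift α x) = inclFst I₁ I₂ x (g₁.sharp x.1 (α x.1)) := by
  rw [← sharp_flat (warpedMetric g₁ g₂ f hf) x (inclFst I₁ I₂ x (g₁.sharp x.1 (α x.1)))]
  congr 1
  ext w
  rw [warpedMetric_apply, mfderiv_fst_inclFst, mfderiv_snd_inclFst, flat_sharp, map_zero,
    zero_apply, mul_zero, add_zero, hlift_apply]

theorem sharp_vlift (α : OneForm I₂ M₂) (x : M₁ × M₂) :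
    (warpedMetric g₁ g₂ f hf).sharp x (vlift α x) =
      (f x.1 ^ 2)⁻¹ • inclSnd I₁ I₂ x (g₂.sharp x.2 (α x.2)) := by
  rw [← sharp_flat (warpedMetric g₁ g₂ f hf) x
    ((f x.1 ^ 2)⁻¹ • inclSnd I₁ I₂ x (g₂.sharp x.2 (α x.2)))]
  congr 1
  ext w
  have hf' := (hf x.1).ne'
  rw [map_smul, smul_apply, warpedMetric_apply, mfderiv_fst_inclSnd,
    mfderiv_snd_inclSnd, flat_sharp, map_zero,
    zero_apply, vlift_apply, zero_add, smul_eq_mul,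
    inv_mul_cancel_left₀ (pow_ne_zero 2 hf')]

theorem warpedBivector_anchor (x : M₁ × M₂) (ξ : TangentSpace (I₁.prod I₂) x →L[ℝ] ℝ) :
    (warpedBivector P₁ P₂ ν).anchor x ξ =
      inclFst I₁ I₂ x (P₁.anchor x.1 (ξ.comp (inclFst I₁ I₂ x))) +
      ν x.1 • inclSnd I₁ I₂ x (P₂.anchor x.2 (ξ.comp (inclSnd I₁ I₂ x))) := rfl

theorem anchor_hlift (α : OneForm I₁ M₁) (x : M₁ × M₂) :
    (warpedBivector P₁ P₂ ν).anchor x (hlift α x) = inclFst I₁ I₂ x (P₁.anchor x.1 (α x.1)) := by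
  have h1 : (hlift α x : TangentSpace (I₁.prod I₂) x →L[ℝ] ℝ).comp (inclFst I₁ I₂ x) = α x.1 := by
    ext u; exact congrArg (α x.1) (mfderiv_fst_inclFst x u)
  have h2 : (hlift α x : TangentSpace (I₁.prod I₂) x →L[ℝ] ℝ).comp (inclSnd I₁ I₂ x) = 0 := by
    ext u; exact (congrArg (α x.1) (mfderiv_fst_inclSnd x u)).trans (map_zero _)
  rw [warpedBivector_anchor, h1, h2, map_zero, map_zero, smul_zero, add_zero]

theorem anchor_vlift (α : OneForm I₂ M₂) (x : M₁ × M₂) :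
    (warpedBivector P₁ P₂ ν).anchor x (vlift α x) =
      ν x.1 • inclSnd I₁ I₂ x (P₂.anchor x.2 (α x.2)) := by
  have h1 : (vlift α x : TangentSpace (I₁.prod I₂) x →L[ℝ] ℝ).comp (inclFst I₁ I₂ x) = 0 := by
    ext u; exact (congrArg (α x.2) (mfderiv_snd_inclFst x u)).trans (map_zero _)
  have h2 : (vlift α x : TangentSpace (I₁.prod I₂) x →L[ℝ] ℝ).comp (inclSnd I₁ I₂ x) = α x.2 := by
    ext u; exact congrArg (α x.2) (mfderiv_snd_inclSnd x u)
  rw [warpedBivector_anchor, h1, h2, map_zero, map_zero, zero_add]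

end Product

section Pointwise

variable {E : Type*} [NormedAddCommGroup E] [NormedSpace ℝ E] [FiniteDimensional ℝ E]
  {H : Type*} [TopologicalSpace H] {I : ModelWithCorners ℝ E H}
  {M : Type*} [TopologicalSpace M] [ChartedSpace H M] [IsManifold I ∞ M]

theorem smul_oneForm_apply (φ : C^∞⟮I, M; ℝ⟯) (α : OneForm I M) (x : M) : (φ • α) x = φ x • α x :=
  rfl

theorem directional_apply (X : SmoothVectorField I M) (φ : C^∞⟮I, M; ℝ⟯) (x : M) :
    directional X φ x = mvfderiv I φ x (X x) := rfl

theorem BivectorField.sharp_apply (P : BivectorField I M) (α : OneForm I M) (x : M) :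
    P.sharp α x = P.anchor x (α x) := rfl

theorem BivectorField.eval_apply (P : BivectorField I M) (α β : OneForm I M) (x : M) :
    P.eval α β x = β x (P.anchor x (α x)) := rfl

theorem BivectorField.eval_antisymm (P : BivectorField I M) (α β : OneForm I M) (x : M) :
    P.eval α β x = -P.eval β α x := P.skew x _ _

theorem BivectorField.eval_self (P : BivectorField I M) (α : OneForm I M) (x : M) :
    P.eval α α x = 0 := by
  linarith [P.eval_antisymm α α x]

theorem cometric_comm (g : PseudoRiemannianMetric I M) (α β : OneForm I M) :
    g.cometric α β = g.cometric β α := by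
  ext x; exact g.symm _ _ _

theorem cometric_add_apply (g : PseudoRiemannianMetric I M) (α β γ : OneForm I M) (x : M) :
    g.cometric (α + β) γ x = g.cometric α γ x + g.cometric β γ x := by
  simp [cometric_eq]

theorem cometric_sub_apply (g : PseudoRiemannianMetric I M) (α β γ : OneForm I M) (x : M) :
    g.cometric (α - β) γ x = g.cometric α γ x - g.cometric β γ x := by
  simp [cometric_eq]

theorem cometric_zero_apply (g : PseudoRiemannianMetric I M) (γ : OneForm I M) (x : M) :
    g.cometric 0 γ x = 0 := by
  simp [cometric_eq]

theorem cometric_smul_apply (g : PseudoRiemannianMetric I M) (φ : C^∞⟮I, M; ℝ⟯)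
    (α γ : OneForm I M) (x : M) : g.cometric (φ • α) γ x = φ x * g.cometric α γ x := by
  rw [cometric_eq, cometric_eq, smul_oneForm_apply]
  rfl

theorem koszul_formula [T2Space M] (g : PseudoRiemannianMetric I M) (P : BivectorField I M)
    (α β γ : OneForm I M) (x : M) :
    2 * g.cometric ((leviCivita g P).deriv α β) γ x =
      mvfderiv I (g.cometric β γ) x (P.anchor x (α x))
      + mvfderiv I (g.cometric α γ) x (P.anchor x (β x))
      - mvfderiv I (g.cometric α β) x (P.anchor x (γ x))
      + g.cometric (P.bracket α β) γ x - g.cometric (P.bracket β γ) α x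
      - g.cometric (P.bracket α γ) β x := by
  rw [two_mul]
  exact congrArg (fun φ : C^∞⟮I, M; ℝ⟯ => φ x) (isLeviCivita_koszul (leviCivita_spec g P) α β γ)

/-- The reciprocal of a positive smooth function. -/
def recip (f : C^∞⟮I, M; ℝ⟯) (hf : ∀ p, 0 < f p) : C^∞⟮I, M; ℝ⟯ :=
  ⟨fun p => (f p)⁻¹, f.contMDiff.inv₀ fun p => (hf p).ne'⟩

theorem recip_apply (f : C^∞⟮I, M; ℝ⟯) (hf : ∀ p, 0 < f p) (p : M) : recip f hf p = (f p)⁻¹ := rfl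

theorem mvfderiv_recip (f : C^∞⟮I, M; ℝ⟯) (hf : ∀ p, 0 < f p) (p : M) (v : TangentSpace I p) :
    mvfderiv I (recip f hf) p v = -((f p)⁻¹ ^ 2 * mvfderiv I f p v) := by
  have h : (f : M → ℝ) * (recip f hf : M → ℝ) = fun _ => 1 := by
    ext y; exact mul_inv_cancel₀ (hf y).ne'
  have h2 := congrArg (fun φ : M → ℝ => mvfderiv I φ p v) h
  have hf' := (hf p).ne'
  simp only [mvfderiv_mul f.mdifferentiableAt (recip f hf).mdifferentiableAt, mvfderiv_const,
    add_apply, smul_apply, recip_apply, smul_eq_mul, zero_apply] at h2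
  field_simp at h2 ⊢
  linarith

end Pointwise

section Product

variable {E₁ : Type*} [NormedAddCommGroup E₁] [NormedSpace ℝ E₁] [FiniteDimensional ℝ E₁]
  {H₁ : Type*} [TopologicalSpace H₁] {I₁ : ModelWithCorners ℝ E₁ H₁}
  {M₁ : Type*} [TopologicalSpace M₁] [ChartedSpace H₁ M₁] [IsManifold I₁ ∞ M₁]
  {E₂ : Type*} [NormedAddCommGroup E₂] [NormedSpace ℝ E₂] [FiniteDimensional ℝ E₂]
  {H₂ : Type*} [TopologicalSpace H₂] {I₂ : ModelWithCorners ℝ E₂ H₂}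
  {M₂ : Type*} [TopologicalSpace M₂] [ChartedSpace H₂ M₂] [IsManifold I₂ ∞ M₂]
  (g₁ : PseudoRiemannianMetric I₁ M₁) (g₂ : PseudoRiemannianMetric I₂ M₂)
  (P₁ : BivectorField I₁ M₁) (P₂ : BivectorField I₂ M₂) (f ν : C^∞⟮I₁, M₁; ℝ⟯) (hf : ∀ p, 0 < f p)

theorem funFst_apply (φ : C^∞⟮I₁, M₁; ℝ⟯) (x : M₁ × M₂) : funFst I₂ M₂ φ x = φ x.1 := rfl

theorem funSnd_apply (φ : C^∞⟮I₂, M₂; ℝ⟯) (x : M₁ × M₂) : funSnd I₁ M₁ φ x = φ x.2 := rfl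

theorem cometric_hlift_hlift (α β : OneForm I₁ M₁) :
    (warpedMetric g₁ g₂ f hf).cometric (hlift α) (hlift β) =
      funFst I₂ M₂ (g₁.cometric α β) := by
  ext x
  rw [cometric_eq, sharp_hlift, hlift_apply, mfderiv_fst_inclFst, funFst_apply, cometric_eq]

theorem cometric_vlift_hlift (α : OneForm I₂ M₂) (β : OneForm I₁ M₁) :
    (warpedMetric g₁ g₂ f hf).cometric (vlift α) (hlift β) = 0 := by
  ext x
  rw [cometric_eq, sharp_hlift, vlift_apply, mfderiv_snd_inclFst, map_zero]
  rfl

theorem cometric_hlift_vlift (α : OneForm I₁ M₁) (β : OneForm I₂ M₂) :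
    (warpedMetric g₁ g₂ f hf).cometric (hlift α) (vlift β) = 0 := by
  rw [cometric_comm, cometric_vlift_hlift]

theorem cometric_vlift_vlift (α β : OneForm I₂ M₂) :
    (warpedMetric g₁ g₂ f hf).cometric (vlift α) (vlift β) =
      funFst I₂ M₂ (recip f hf * recip f hf) * funSnd I₁ M₁ (g₂.cometric α β) := by
  ext x
  rw [cometric_eq, sharp_vlift, map_smul, vlift_apply, mfderiv_snd_inclSnd, ← cometric_eq, pow_two,
    mul_inv]
  rfl

theorem ext_of_cometric_lifts [T2Space M₁] [T2Space M₂] {A B : OneForm (I₁.prod I₂) (M₁ × M₂)}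
    (h₁ : ∀ (γ : OneForm I₁ M₁) x, (warpedMetric g₁ g₂ f hf).cometric A (hlift γ) x =
      (warpedMetric g₁ g₂ f hf).cometric B (hlift γ) x)
    (h₂ : ∀ (γ : OneForm I₂ M₂) x, (warpedMetric g₁ g₂ f hf).cometric A (vlift γ) x =
      (warpedMetric g₁ g₂ f hf).cometric B (vlift γ) x) : A = B := by
  refine ContMDiffSection.ext fun x => ContinuousLinearMap.ext fun v => ?_
  obtain ⟨γ₁, hγ₁⟩ := exists_oneForm_eq (g₁.toFun x.1 (mfderiv (I₁.prod I₂) I₁ Prod.fst x v))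
  obtain ⟨γ₂, hγ₂⟩ := exists_oneForm_eq (g₂.toFun x.2 (mfderiv (I₁.prod I₂) I₂ Prod.snd x v))
  have k₁ := h₁ γ₁ x
  have k₂ := h₂ γ₂ x
  rw [cometric_eq, cometric_eq, sharp_hlift, hγ₁, sharp_flat] at k₁
  rw [cometric_eq, cometric_eq, sharp_vlift, hγ₂, sharp_flat, map_smul, map_smul] at k₂
  have k₃ := smul_right_injective ℝ (inv_ne_zero (pow_ne_zero 2 (hf x.1).ne')) k₂
  rw [← inclFst_add_inclSnd x v, map_add, map_add, k₁, k₃]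

theorem eval_hlift_hlift (α β : OneForm I₁ M₁) :
    (warpedBivector P₁ P₂ ν).eval (hlift α) (hlift β) = funFst I₂ M₂ (P₁.eval α β) := by
  ext x
  rw [BivectorField.eval_apply, anchor_hlift, hlift_apply, mfderiv_fst_inclFst]
  rfl

theorem eval_hlift_vlift (α : OneForm I₁ M₁) (β : OneForm I₂ M₂) :
    (warpedBivector P₁ P₂ ν).eval (hlift α) (vlift β) = 0 := by
  ext x
  rw [BivectorField.eval_apply, anchor_hlift, vlift_apply, mfderiv_snd_inclFst, map_zero]
  rfl

theorem eval_vlift_hlift (α : OneForm I₂ M₂) (β : OneForm I₁ M₁) :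
    (warpedBivector P₁ P₂ ν).eval (vlift α) (hlift β) = 0 := by
  ext x
  rw [BivectorField.eval_apply, anchor_vlift, map_smul, hlift_apply, mfderiv_fst_inclSnd, map_zero,
    smul_zero]
  rfl

theorem eval_vlift_vlift (α β : OneForm I₂ M₂) :
    (warpedBivector P₁ P₂ ν).eval (vlift α) (vlift β) =
      funFst I₂ M₂ ν * funSnd I₁ M₁ (P₂.eval α β) := by
  ext x
  rw [BivectorField.eval_apply, anchor_vlift, map_smul, vlift_apply, mfderiv_snd_inclSnd]
  rfl

theorem differential_funFst (φ : C^∞⟮I₁, M₁; ℝ⟯) :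
    differential (funFst I₂ M₂ φ) = hlift (differential φ) :=
  ContMDiffSection.ext fun x => ContinuousLinearMap.ext fun v => mvfderiv_funFst φ x v

theorem differential_zero : differential (0 : C^∞⟮I₁, M₁; ℝ⟯) = 0 :=
  ContMDiffSection.ext fun _ => mvfderiv_zero

theorem mvfderiv_funFst_mul_funSnd (φ : C^∞⟮I₁, M₁; ℝ⟯) (ψ : C^∞⟮I₂, M₂; ℝ⟯) (x : M₁ × M₂)
    (v : TangentSpace (I₁.prod I₂) x) :
    mvfderiv (I₁.prod I₂) (⇑(funFst I₂ M₂ φ) * ⇑(funSnd I₁ M₁ ψ)) x v =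
      φ x.1 * mvfderiv I₂ ψ x.2 (mfderiv (I₁.prod I₂) I₂ Prod.snd x v) +
      ψ x.2 * mvfderiv I₁ φ x.1 (mfderiv (I₁.prod I₂) I₁ Prod.fst x v) := by
  rw [mvfderiv_mul (funFst I₂ M₂ φ).mdifferentiableAt
    (funSnd I₁ M₁ ψ).mdifferentiableAt, add_apply, smul_apply, smul_apply, mvfderiv_funFst,
    mvfderiv_funSnd]
  rfl

theorem mfderiv_fst_sharp_hlift (α : OneForm I₁ M₁) (x : M₁ × M₂) :
    mfderiv (I₁.prod I₂) I₁ Prod.fst x ((warpedBivector P₁ P₂ ν).sharp (hlift α) x) =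
      P₁.sharp α x.1 := by
  rw [BivectorField.sharp_apply, anchor_hlift, mfderiv_fst_inclFst]
  rfl

theorem mfderiv_snd_sharp_hlift (α : OneForm I₁ M₁) (x : M₁ × M₂) :
    mfderiv (I₁.prod I₂) I₂ Prod.snd x ((warpedBivector P₁ P₂ ν).sharp (hlift α) x) =
      (0 : SmoothVectorField I₂ M₂) x.2 := by
  rw [BivectorField.sharp_apply, anchor_hlift, mfderiv_snd_inclFst]
  rfl

theorem mfderiv_fst_sharp_vlift (α : OneForm I₂ M₂) (x : M₁ × M₂) :
    mfderiv (I₁.prod I₂) I₁ Prod.fst x ((warpedBivector P₁ P₂ ν).sharp (vlift α) x) =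
      (0 : SmoothVectorField I₁ M₁) x.1 := by
  rw [BivectorField.sharp_apply, anchor_vlift, map_smul, mfderiv_fst_inclSnd, smul_zero]
  rfl

theorem mfderiv_snd_vliftField (Z : SmoothVectorField I₂ M₂) (x : M₁ × M₂) :
    mfderiv (I₁.prod I₂) I₂ Prod.snd x (vliftField I₁ M₁ Z x) = Z x.2 :=
  mfderiv_snd_inclSnd x _

theorem bracket_hlift_hlift (α β : OneForm I₁ M₁) :
    (warpedBivector P₁ P₂ ν).bracket (hlift α) (hlift β) = hlift (P₁.bracket α β) := by
  rw [BivectorField.bracket, lieDerivative_hlift (mfderiv_fst_sharp_hlift P₁ P₂ ν α),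
    lieDerivative_hlift (mfderiv_fst_sharp_hlift P₁ P₂ ν β), eval_hlift_hlift, differential_funFst]
  rfl

theorem bracket_hlift_vlift (α : OneForm I₁ M₁) (β : OneForm I₂ M₂) :
    (warpedBivector P₁ P₂ ν).bracket (hlift α) (vlift β) = 0 := by
  rw [BivectorField.bracket, lieDerivative_vlift (mfderiv_snd_sharp_hlift P₁ P₂ ν α),
    lieDerivative_hlift (mfderiv_fst_sharp_vlift P₁ P₂ ν β), eval_hlift_vlift, lieDerivative_zero,
    lieDerivative_zero, differential_zero, hlift_zero, vlift_zero, sub_zero, sub_zero]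

theorem bracket_vlift_hlift (α : OneForm I₂ M₂) (β : OneForm I₁ M₁) :
    (warpedBivector P₁ P₂ ν).bracket (vlift α) (hlift β) = 0 := by
  rw [BivectorField.bracket, lieDerivative_vlift (mfderiv_snd_sharp_hlift P₁ P₂ ν β),
    lieDerivative_hlift (mfderiv_fst_sharp_vlift P₁ P₂ ν α), eval_vlift_hlift, lieDerivative_zero,
    lieDerivative_zero, differential_zero, hlift_zero, vlift_zero, sub_zero, sub_zero]

theorem lieDerivative_sharp_vlift_apply (α β : OneForm I₂ M₂) (x : M₁ × M₂)
    (v : TangentSpace (I₁.prod I₂) x) :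
    lieDerivative ((warpedBivector P₁ P₂ ν).sharp (vlift α)) (vlift β) x v =
      ν x.1 * (vlift (lieDerivative (P₂.sharp α) β) : OneForm (I₁.prod I₂) (M₁ × M₂)) x v +
      P₂.eval α β x.2 *
        (hlift (differential ν) : OneForm (I₁.prod I₂) (M₁ × M₂)) x v := by
  rw [lieDerivative_smul_apply (Y := vliftField I₁ M₁ (P₂.sharp α)) (h := funFst I₂ M₂ ν)
    (anchor_vlift P₁ P₂ ν α), lieDerivative_vlift (mfderiv_snd_vliftField _), vlift_apply β,
    mfderiv_snd_vliftField, mvfderiv_funFst]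
  rfl

theorem bracket_vlift_vlift (α β : OneForm I₂ M₂) :
    (warpedBivector P₁ P₂ ν).bracket (vlift α) (vlift β) =
      funFst I₂ M₂ ν • vlift (P₂.bracket α β) +
      funSnd I₁ M₁ (P₂.eval α β) • hlift (differential ν) := by
  refine ContMDiffSection.ext fun x => ContinuousLinearMap.ext fun v => ?_
  have h1 := lieDerivative_sharp_vlift_apply P₁ P₂ ν α β x v
  have h2 := lieDerivative_sharp_vlift_apply P₁ P₂ ν β α x v
  have h3 : differential ((warpedBivector P₁ P₂ ν).eval (vlift α) (vlift β)) x v =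
      ν x.1 * (vlift (differential (P₂.eval α β)) : OneForm (I₁.prod I₂) (M₁ × M₂)) x v +
      P₂.eval α β x.2 *
        (hlift (differential ν) : OneForm (I₁.prod I₂) (M₁ × M₂)) x v := by
    rw [eval_vlift_vlift]
    exact mvfderiv_funFst_mul_funSnd ν (P₂.eval α β) x v
  change lieDerivative ((warpedBivector P₁ P₂ ν).sharp (vlift α)) (vlift β) x v -
    lieDerivative ((warpedBivector P₁ P₂ ν).sharp (vlift β)) (vlift α) x v -
    differential ((warpedBivector P₁ P₂ ν).eval (vlift α) (vlift β)) x v = ν x.1 * (vlift (lieDerivative (P₂.sharp α) β) x v -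
      vlift (lieDerivative (P₂.sharp β) α) x v - vlift (differential (P₂.eval α β)) x v) +
    P₂.eval α β x.2 * hlift (differential ν) x v
  rw [h1, h2, h3, P₂.eval_antisymm β α]
  ring

end Product

section Pointwise

variable {E : Type*} [NormedAddCommGroup E] [NormedSpace ℝ E] [FiniteDimensional ℝ E]
  {H : Type*} [TopologicalSpace H] {I : ModelWithCorners ℝ E H}
  {M : Type*} [TopologicalSpace M] [ChartedSpace H M] [IsManifold I ∞ M]

theorem mvfderiv_anchor (P : BivectorField I M) (φ : C^∞⟮I, M; ℝ⟯) (α : OneForm I M) (x : M) :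
    mvfderiv I φ x (P.anchor x (α x)) = -P.eval (differential φ) α x :=
  P.skew x (α x) (mvfderiv I φ x)

theorem mvfderiv_recip_mul_recip (f : C^∞⟮I, M; ℝ⟯) (hf : ∀ p, 0 < f p) (p : M)
    (v : TangentSpace I p) : mvfderiv I (⇑(recip f hf) * ⇑(recip f hf)) p v =
      -2 * ((f p)⁻¹ ^ 3 * mvfderiv I f p v) := by
  rw [mvfderiv_mul (recip f hf).mdifferentiableAt
    (recip f hf).mdifferentiableAt, add_apply, smul_apply, mvfderiv_recip, recip_apply, smul_eq_mul]
  ring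

theorem coe_funZero : ((0 : C^∞⟮I, M; ℝ⟯) : M → ℝ) = 0 := rfl

end Pointwise

section Product

variable {E₁ : Type*} [NormedAddCommGroup E₁] [NormedSpace ℝ E₁] [FiniteDimensional ℝ E₁]
  {H₁ : Type*} [TopologicalSpace H₁] {I₁ : ModelWithCorners ℝ E₁ H₁}
  {M₁ : Type*} [TopologicalSpace M₁] [T2Space M₁] [ChartedSpace H₁ M₁] [IsManifold I₁ ∞ M₁]
  {E₂ : Type*} [NormedAddCommGroup E₂] [NormedSpace ℝ E₂] [FiniteDimensional ℝ E₂]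
  {H₂ : Type*} [TopologicalSpace H₂] {I₂ : ModelWithCorners ℝ E₂ H₂}
  {M₂ : Type*} [TopologicalSpace M₂] [T2Space M₂] [ChartedSpace H₂ M₂] [IsManifold I₂ ∞ M₂]
  (g₁ : PseudoRiemannianMetric I₁ M₁) (g₂ : PseudoRiemannianMetric I₂ M₂)
  (P₁ : BivectorField I₁ M₁) (P₂ : BivectorField I₂ M₂) (f ν : C^∞⟮I₁, M₁; ℝ⟯) (hf : ∀ p, 0 < f p)

theorem deriv_hlift_hlift (α β : OneForm I₁ M₁) :
    (leviCivita (warpedMetric g₁ g₂ f hf) (warpedBivector P₁ P₂ ν)).deriv (hlift α) (hlift β) =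
      hlift ((leviCivita g₁ P₁).deriv α β) := by
  refine ext_of_cometric_lifts g₁ g₂ f hf (fun γ x => ?_) fun γ x => ?_
  · have h := koszul_formula (warpedMetric g₁ g₂ f hf) (warpedBivector P₁ P₂ ν)
      (hlift α) (hlift β) (hlift γ) x
    have h1 := koszul_formula g₁ P₁ α β γ x.1
    simp only [bracket_hlift_hlift, cometric_hlift_hlift, anchor_hlift, mvfderiv_funFst,
      mfderiv_fst_inclFst, funFst_apply] at h ⊢
    linarith
  · have h := koszul_formula (warpedMetric g₁ g₂ f hf) (warpedBivector P₁ P₂ ν)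
      (hlift α) (hlift β) (vlift γ) x
    simp only [bracket_hlift_hlift, bracket_hlift_vlift, cometric_hlift_hlift,
      cometric_hlift_vlift, anchor_vlift, map_smul, mvfderiv_funFst, cometric_zero_apply,
      mfderiv_fst_inclSnd, coe_funZero, mvfderiv_zero, Pi.zero_apply, zero_apply, map_zero,
      smul_zero] at h ⊢
    linarith

theorem deriv_hlift_vlift (α : OneForm I₁ M₁) (β : OneForm I₂ M₂) :
    (leviCivita (warpedMetric g₁ g₂ f hf) (warpedBivector P₁ P₂ ν)).deriv (hlift α) (vlift β) =
      funFst I₂ M₂ (recip f hf * P₁.eval (differential f) α) • vlift β +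
      funFst I₂ M₂ ((-2⁻¹ : ℝ) • (f * f * g₁.cometric (differential ν) α)) •
        vlift (JField g₂ P₂ β) := by
  refine ext_of_cometric_lifts g₁ g₂ f hf (fun γ x => ?_) fun γ x => ?_
  · have h := koszul_formula (warpedMetric g₁ g₂ f hf) (warpedBivector P₁ P₂ ν)
      (hlift α) (vlift β) (hlift γ) x
    simp only [bracket_hlift_hlift, bracket_hlift_vlift, bracket_vlift_hlift, cometric_hlift_hlift,
      cometric_hlift_vlift, cometric_vlift_hlift, anchor_vlift, map_smul, mvfderiv_funFst,
      cometric_zero_apply, cometric_add_apply, cometric_smul_apply,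
      mfderiv_fst_inclSnd, coe_funZero, mvfderiv_zero, Pi.zero_apply, zero_apply, map_zero,
      smul_zero, mul_zero] at h ⊢
    linarith
  · have h := koszul_formula (warpedMetric g₁ g₂ f hf) (warpedBivector P₁ P₂ ν)
      (hlift α) (vlift β) (vlift γ) x
    have hfx := (hf x.1).ne'
    simp only [bracket_hlift_vlift, bracket_vlift_vlift, cometric_hlift_hlift,
      cometric_hlift_vlift, cometric_vlift_hlift, cometric_vlift_vlift, cometric_JField,
      anchor_vlift, anchor_hlift, map_smul, mvfderiv_funFst_mul_funSnd, mvfderiv_recip_mul_recip,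
      mfderiv_snd_inclFst, mfderiv_fst_inclFst, mvfderiv_anchor, funFst_apply, funSnd_apply,
      cometric_zero_apply, cometric_add_apply, cometric_smul_apply,
      ContMDiffMap.coe_mul, ContMDiffMap.coe_smul, Pi.mul_apply, Pi.smul_apply, smul_eq_mul,
      recip_apply, coe_funZero, mvfderiv_zero, Pi.zero_apply, zero_apply, map_zero,
      mul_zero] at h ⊢
    field_simp at h ⊢
    linarith

theorem deriv_vlift_hlift (α : OneForm I₂ M₂) (β : OneForm I₁ M₁) :
    (leviCivita (warpedMetric g₁ g₂ f hf) (warpedBivector P₁ P₂ ν)).deriv (vlift α) (hlift β) =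
      funFst I₂ M₂ (recip f hf * P₁.eval (differential f) β) • vlift α +
      funFst I₂ M₂ ((-2⁻¹ : ℝ) • (f * f * g₁.cometric (differential ν) β)) •
        vlift (JField g₂ P₂ α) := by
  have h := (leviCivita_spec (warpedMetric g₁ g₂ f hf) (warpedBivector P₁ P₂ ν)).torsion_free
    (vlift α) (hlift β)
  rw [bracket_vlift_hlift, sub_eq_zero] at h
  rw [h, deriv_hlift_vlift]

theorem deriv_vlift_vlift (α β : OneForm I₂ M₂) :
    (leviCivita (warpedMetric g₁ g₂ f hf) (warpedBivector P₁ P₂ ν)).deriv (vlift α) (vlift β) =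
      funSnd I₁ M₁ (g₂.cometric α β) •
        hlift (((-1 : ℝ) • (recip f hf * recip f hf * recip f hf)) • JField g₁ P₁ (differential f)) +
      funSnd I₁ M₁ ((2⁻¹ : ℝ) • P₂.eval α β) • hlift (differential ν) +
      funFst I₂ M₂ ν • vlift ((leviCivita g₂ P₂).deriv α β) := by
  refine ext_of_cometric_lifts g₁ g₂ f hf (fun γ x => ?_) fun γ x => ?_
  · have h := koszul_formula (warpedMetric g₁ g₂ f hf) (warpedBivector P₁ P₂ ν)
      (vlift α) (vlift β) (hlift γ) x
    have hfx := (hf x.1).ne'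
    simp only [bracket_vlift_vlift, bracket_vlift_hlift, cometric_hlift_hlift,
      cometric_vlift_hlift, cometric_vlift_vlift, cometric_JField,
      anchor_vlift, anchor_hlift, map_smul, mvfderiv_funFst_mul_funSnd, mvfderiv_recip_mul_recip,
      mfderiv_snd_inclFst, mfderiv_fst_inclFst, mvfderiv_anchor, funFst_apply, funSnd_apply,
      cometric_zero_apply, cometric_add_apply, cometric_smul_apply,
      ContMDiffMap.coe_mul, ContMDiffMap.coe_smul, Pi.mul_apply, Pi.smul_apply, smul_eq_mul,
      recip_apply, coe_funZero, mvfderiv_zero, Pi.zero_apply, zero_apply, map_zero,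
      mul_zero] at h ⊢
    field_simp at h ⊢
    linarith
  · have h := koszul_formula (warpedMetric g₁ g₂ f hf) (warpedBivector P₁ P₂ ν)
      (vlift α) (vlift β) (vlift γ) x
    have h₂ := koszul_formula g₂ P₂ α β γ x.2
    simp only [bracket_vlift_vlift, cometric_hlift_vlift, cometric_vlift_vlift,
      anchor_vlift, map_smul, mvfderiv_funFst_mul_funSnd, smul_eq_mul,
      mfderiv_snd_inclSnd, mfderiv_fst_inclSnd, funFst_apply, funSnd_apply,
      cometric_add_apply, cometric_smul_apply, ContMDiffMap.coe_mul, Pi.mul_apply,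
      coe_funZero, Pi.zero_apply, map_zero, mul_zero] at h ⊢
    linear_combination h / 2 - (ν x.1 * (recip f hf x.1 * recip f hf x.1)) / 2 * h₂

end Product

section Pointwise

variable {E : Type*} [NormedAddCommGroup E] [NormedSpace ℝ E] [FiniteDimensional ℝ E]
  {H : Type*} [TopologicalSpace H] {I : ModelWithCorners ℝ E H}
  {M : Type*} [TopologicalSpace M] [ChartedSpace H M] [IsManifold I ∞ M]

theorem ContravariantConnection.deriv_zero_left {P : BivectorField I M}
    (D : ContravariantConnection P) (β : OneForm I M) : D.deriv 0 β = 0 := by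
  have h := D.add_left 0 0 β
  rwa [add_zero, left_eq_add] at h

theorem mvfderiv_neg_recip_cube (f : C^∞⟮I, M; ℝ⟯) (hf : ∀ p, 0 < f p) (p : M)
    (v : TangentSpace I p) :
    mvfderiv I ((-1 : ℝ) • (⇑(recip f hf) * ⇑(recip f hf) * ⇑(recip f hf))) p v =
      3 * ((f p)⁻¹ ^ 4 * mvfderiv I f p v) := by
  have hr : MDiffAt (recip f hf : M → ℝ) p := (recip f hf).mdifferentiableAt
  have h : (-1 : ℝ) • (⇑(recip f hf) * ⇑(recip f hf) * ⇑(recip f hf)) =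
      -(⇑(recip f hf) * ⇑(recip f hf) * ⇑(recip f hf)) := neg_one_smul ℝ _
  rw [h, mvfderiv_neg, mvfderiv_mul (hr.mul hr) hr, neg_apply, add_apply, smul_apply, smul_apply,
    mvfderiv_recip_mul_recip, mvfderiv_recip, Pi.mul_apply, recip_apply, smul_eq_mul, smul_eq_mul]
  ring

theorem BivectorField.eval_smul_right_apply (P : BivectorField I M) (φ : C^∞⟮I, M; ℝ⟯)
    (α β : OneForm I M) (x : M) : P.eval α (φ • β) x = φ x * P.eval α β x := rfl

theorem cometric_JField_right (g : PseudoRiemannianMetric I M) (P : BivectorField I M)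
    (α β : OneForm I M) : g.cometric α (JField g P β) = P.eval β α := by
  rw [cometric_comm, cometric_JField]

theorem cometric_smul_right_apply (g : PseudoRiemannianMetric I M) (φ : C^∞⟮I, M; ℝ⟯)
    (α γ : OneForm I M) (x : M) : g.cometric γ (φ • α) x = φ x * g.cometric γ α x := by
  rw [cometric_comm, cometric_smul_apply, cometric_comm]

end Pointwise

section Product

variable {E₁ : Type*} [NormedAddCommGroup E₁] [NormedSpace ℝ E₁] [FiniteDimensional ℝ E₁]
  {H₁ : Type*} [TopologicalSpace H₁] {I₁ : ModelWithCorners ℝ E₁ H₁}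
  {M₁ : Type*} [TopologicalSpace M₁] [T2Space M₁] [ChartedSpace H₁ M₁] [IsManifold I₁ ∞ M₁]
  {E₂ : Type*} [NormedAddCommGroup E₂] [NormedSpace ℝ E₂] [FiniteDimensional ℝ E₂]
  {H₂ : Type*} [TopologicalSpace H₂] {I₂ : ModelWithCorners ℝ E₂ H₂}
  {M₂ : Type*} [TopologicalSpace M₂] [T2Space M₂] [ChartedSpace H₂ M₂] [IsManifold I₂ ∞ M₂]
  (g₁ : PseudoRiemannianMetric I₁ M₁) (g₂ : PseudoRiemannianMetric I₂ M₂)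
  (P₁ : BivectorField I₁ M₁) (P₂ : BivectorField I₂ M₂) (f ν : C^∞⟮I₁, M₁; ℝ⟯) (hf : ∀ p, 0 < f p)

theorem curvature_hlift_hlift (α β γ : OneForm I₁ M₁) :
    curvature (warpedMetric g₁ g₂ f hf) (warpedBivector P₁ P₂ ν) (hlift α) (hlift β) (hlift γ) =
      hlift (curvature g₁ P₁ α β γ) := by
  simp only [curvature, deriv_hlift_hlift, bracket_hlift_hlift]
  rfl

theorem cometric_curvature_hlift_vlift (α : OneForm I₁ M₁) (β : OneForm I₂ M₂) (x : M₁ × M₂) :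
    (warpedMetric g₁ g₂ f hf).cometric (curvature (warpedMetric g₁ g₂ f hf)
        (warpedBivector P₁ P₂ ν) (hlift α) (vlift β) (vlift β)) (hlift α) x =
      g₂.cometric β β x.2 *
        (-((f x.1)⁻¹ ^ 3 *
            g₁.cometric ((leviCivita g₁ P₁).deriv α (JField g₁ P₁ (differential f))) α x.1) -
          2 * (f x.1)⁻¹ ^ 4 * P₁.eval (differential f) α x.1 ^ 2) +
      f x.1 ^ 2 / 4 * P₂.eval β (JField g₂ P₂ β) x.2 * g₁.cometric (differential ν) α x.1 ^ 2 := by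
  have hfx := (hf x.1).ne'
  simp only [curvature, bracket_hlift_vlift, ContravariantConnection.deriv_zero_left,
    deriv_vlift_vlift, deriv_hlift_vlift, deriv_hlift_hlift, ContravariantConnection.add_right,
    ContravariantConnection.leibniz, cometric_add_apply, cometric_sub_apply, cometric_smul_apply,
    cometric_hlift_hlift, cometric_vlift_hlift, cometric_JField,
    cometric_JField_right, coe_funZero, Pi.zero_apply, funFst_apply, funSnd_apply,
    directional_apply, BivectorField.sharp_apply, anchor_hlift, mvfderiv_funSnd,
    mfderiv_snd_inclFst, map_zero, ContMDiffMap.coe_smul, ContMDiffMap.coe_mul,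
    mvfderiv_neg_recip_cube, mvfderiv_anchor, Pi.smul_apply, Pi.mul_apply, smul_eq_mul,
    recip_apply, BivectorField.eval_self, mul_zero, zero_mul, add_zero, sub_zero, zero_add]
  field_simp
  ring

theorem cometric_curvature_vlift_vlift (α β : OneForm I₂ M₂) (x : M₁ × M₂) :
    (warpedMetric g₁ g₂ f hf).cometric (curvature (warpedMetric g₁ g₂ f hf)
        (warpedBivector P₁ P₂ ν) (vlift α) (vlift β) (vlift β)) (vlift α) x =
      (f x.1)⁻¹ ^ 2 * (ν x.1 ^ 2 * g₂.cometric (curvature g₂ P₂ α β β) α x.2 -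
        (f x.1)⁻¹ ^ 4 * P₁.eval (differential f) (JField g₁ P₁ (differential f)) x.1 *
          gram g₂ α β x.2 -
        3 / 4 * f x.1 ^ 2 * g₁.cometric (differential ν) (differential ν) x.1 *
          P₂.eval α β x.2 ^ 2 -
        (f x.1)⁻¹ * P₁.eval (differential f) (differential ν) x.1 * g₂.cometric α β x.2 *
          P₂.eval α β x.2) := by
  have hfx := (hf x.1).ne'
  simp only [curvature, bracket_vlift_vlift, ContravariantConnection.add_left,
    ContravariantConnection.smul_left,
    deriv_vlift_vlift, deriv_vlift_hlift, deriv_hlift_vlift, ContravariantConnection.add_right,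
    ContravariantConnection.leibniz, cometric_add_apply, cometric_sub_apply, cometric_smul_apply,
    cometric_smul_right_apply, BivectorField.eval_smul_right_apply,
    cometric_vlift_vlift, cometric_hlift_vlift, cometric_JField,
    cometric_JField_right, coe_funZero, Pi.zero_apply, funFst_apply, funSnd_apply,
    directional_apply, BivectorField.sharp_apply, anchor_vlift, map_smul, mvfderiv_funFst,
    mfderiv_fst_inclSnd, map_zero, ContMDiffMap.coe_smul, ContMDiffMap.coe_mul,
    Pi.smul_apply, Pi.mul_apply, smul_eq_mul, gram, P₂.eval_antisymm β α,
    cometric_comm g₂ β α,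
    recip_apply, BivectorField.eval_self, mul_zero, zero_mul, add_zero, zero_add]
  field_simp
  ring

end Product

end

end PoissonWarped

open PoissonWarped
open scoped Manifold ContDiff
theorem lemma3p1
    {E₁ : Type*} [NormedAddCommGroup E₁] [NormedSpace ℝ E₁] [FiniteDimensional ℝ E₁]
    {H₁ : Type*} [TopologicalSpace H₁] {I₁ : ModelWithCorners ℝ E₁ H₁}
    {M₁ : Type*} [TopologicalSpace M₁] [T2Space M₁] [ChartedSpace H₁ M₁]
    [IsManifold I₁ ∞ M₁] [BoundarylessManifold I₁ M₁]
    {E₂ : Type*} [NormedAddCommGroup E₂] [NormedSpace ℝ E₂] [FiniteDimensional ℝ E₂]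
    {H₂ : Type*} [TopologicalSpace H₂] {I₂ : ModelWithCorners ℝ E₂ H₂}
    {M₂ : Type*} [TopologicalSpace M₂] [T2Space M₂] [ChartedSpace H₂ M₂]
    [IsManifold I₂ ∞ M₂] [BoundarylessManifold I₂ M₂]
    (g₁ : PseudoRiemannianMetric I₁ M₁) (g₂ : PseudoRiemannianMetric I₂ M₂)
    (P₁ : BivectorField I₁ M₁) (hP₁ : P₁.IsPoisson)
    (P₂ : BivectorField I₂ M₂) (hP₂ : P₂.IsPoisson)
    (f₁ ν₁ : C^∞⟮I₁, M₁; ℝ⟯) (hf₁ : ∀ p, 0 < f₁ p)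
    (ω₁ η₁ : OneForm I₁ M₁) (ω₂ η₂ : OneForm I₂ M₂) (p : M₁) (q : M₂) :
    (gram g₁ ω₁ η₁ p ≠ 0 →
      sectionalCurvature (warpedMetric g₁ g₂ f₁ hf₁) (warpedBivector P₁ P₂ ν₁)
          (hlift ω₁) (hlift η₁) (p, q) =
        sectionalCurvature g₁ P₁ ω₁ η₁ p) ∧
    (g₁.cometric ω₁ ω₁ p ≠ 0 → g₂.cometric η₂ η₂ q ≠ 0 →
      sectionalCurvature (warpedMetric g₁ g₂ f₁ hf₁) (warpedBivector P₁ P₂ ν₁)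
          (hlift ω₁) (vlift η₂) (p, q) =
        - (g₁.cometric ((leviCivita g₁ P₁).deriv ω₁ (JField g₁ P₁ (differential f₁))) ω₁ p /
            (f₁ p * g₁.cometric ω₁ ω₁ p))
        - 2 * g₁.cometric (JField g₁ P₁ (differential f₁)) ω₁ p ^ 2 /
            (f₁ p ^ 2 * g₁.cometric ω₁ ω₁ p)
        + g₂.cometric (JField g₂ P₂ η₂) (JField g₂ P₂ η₂) q *
              (f₁ p ^ 2 * g₁.cometric (differential ν₁) ω₁ p) ^ 2 /
            (4 * g₁.cometric ω₁ ω₁ p * g₂.cometric η₂ η₂ q)) ∧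
    (gram g₂ ω₂ η₂ q ≠ 0 →
      sectionalCurvature (warpedMetric g₁ g₂ f₁ hf₁) (warpedBivector P₁ P₂ ν₁)
          (vlift ω₂) (vlift η₂) (p, q) =
        ν₁ p ^ 2 * f₁ p ^ 2 * sectionalCurvature g₂ P₂ ω₂ η₂ q
        - g₁.cometric (JField g₁ P₁ (differential f₁)) (JField g₁ P₁ (differential f₁)) p /
            f₁ p ^ 2
        - (3 * f₁ p ^ 4 * g₁.cometric (differential ν₁) (differential ν₁) p *
              g₂.cometric (JField g₂ P₂ ω₂) η₂ q ^ 2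
            + 4 * (f₁ p * g₁.cometric (differential ν₁) (JField g₁ P₁ (differential f₁)) p) *
              g₂.cometric ω₂ η₂ q * g₂.cometric (JField g₂ P₂ ω₂) η₂ q) /
          (4 * (g₂.cometric ω₂ ω₂ q * g₂.cometric η₂ η₂ q - g₂.cometric ω₂ η₂ q ^ 2))) := by
  have hfp := (hf₁ p).ne'
  refine ⟨fun _ => ?_, fun h1 h2 => ?_, fun h => ?_⟩
  · simp only [sectionalCurvature, gram, curvature_hlift_hlift, cometric_hlift_hlift, funFst_apply]
  · simp only [sectionalCurvature, gram, cometric_curvature_hlift_vlift, cometric_hlift_hlift,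
      cometric_hlift_vlift, cometric_vlift_vlift, cometric_JField, ContMDiffMap.coe_mul,
      Pi.mul_apply, coe_funZero, Pi.zero_apply, funFst_apply, funSnd_apply, recip_apply]
    field_simp
    ring
  · have hG : gram (warpedMetric g₁ g₂ f₁ hf₁) (vlift ω₂) (vlift η₂) (p, q) =
        (f₁ p)⁻¹ ^ 4 * gram g₂ ω₂ η₂ q := by
      simp only [gram, cometric_vlift_vlift, ContMDiffMap.coe_mul, Pi.mul_apply, funFst_apply,
        funSnd_apply, recip_apply]
      ring
    have hg : g₂.cometric ω₂ ω₂ q * g₂.cometric η₂ η₂ q - g₂.cometric ω₂ η₂ q ^ 2 =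
      gram g₂ ω₂ η₂ q := rfl
    rw [sectionalCurvature, hG, hg, cometric_curvature_vlift_vlift, sectionalCurvature]
    simp only [cometric_JField, cometric_JField_right]
    field_simp
    ring
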